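/- Let $I$ be a finite set. A tree on $I$ is a rooted binary tree, not considered as planar, whose leaves are bijectively labelled by $I$ (every inner vertex has two incoming edges and one outgoing edge, edges being oriented towards the root); a forest on $I$ is a set of such trees on the blocks of a partition of $I$. For a forest $F$, let $\mathcal V(F)$ be its set of inner vertices. For forests $F,G$ on $I$ write $F\le G$ if there is a topological map from $F$ to $G$ that is increasing with respect to the orientation towards the root, maps inner vertices injectively to inner vertices, is the identity on the leaves, and is injective on each tree of $F$. This is a partial order, with least element $\hat 0$, the forest without inner vertices. The map, up to isotopy, is unique, and is used to regard $\mathcal V(F)$ as a subset of $\mathcal V(G)$ when $F\le G$. Let $T$ be a tree on $I$ with $n$ inner vertices. The atoms of the interval $[\hat 0,T]$ are the forests $(i,j)$ whose only inner vertex joins two distinct leaves $i,j\in I$; the vertex of the atom $(i,j)$ is the inner vertex $v_{(i,j)}$ of $T$ at which the paths from $i$ and $j$ to the root meet. A nice total order on $\mathcal V(T)$ is a total order $\preceq$ such that $v\preceq v'$ whenever $v'$ is on the path from $v$ to the root; it numbers $\mathcal V(T)$ by $1,\dots,n$ in increasing order. The label $\lambda(F,G)$ of a covering relation $F\lhd G$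 in $[\hat 0,T]$ is the number of the vertex $v$ with $\mathcal V(G)=\mathcal V(F)\sqcup\{v\}$. An element $x$ of a lattice is left-modular if $y\vee(x\wedge z)=(y\vee x)\wedge z$ for all $y\le z$. Given a maximal chain $m:\hat 0=x_0\lhd x_1\lhd\dots\lhd x_n=\hat 1$ of a finite lattice, let $A_i$ be the set of atoms $a$ with $a\le x_i$ and $a\not\le x_{i-1}$, and for atoms write $a\lhd_m b$ if $a\in A_i$ and $b\in A_j$ with $i<j$. The chain $m$ satisfies the level condition if, for all atoms $a_0\lhd_m a_1\lhd_m\dots\lhd_m a_k$, one has $a_0\not\le a_1\vee\dots\vee a_k$. An LL-lattice is a lattice that has a maximal chain which satisfies the level condition and all of whose elements are left-modular. Then: (1) $[\hat 0,T]$ is an LL-lattice (in particular, a lattice). (2) Each atom of $[\hat 0,T]$ has exactly one vertex, and if $a_1,\dots,a_k$ are atoms with pairwise distinct vertices $v_1,\dots,v_k$, then $\mathcal V(a_1\vee\dots\vee a_k)=\{v_1,\dots,v_k\}$. (3) For every nice total order on $\mathcal V(T)$ there is exactly one maximal chain $\hat 0=x_0\lhd x_1\lhd\dots\lhd x_n=T$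 whose sequence of labels is increasing. All elements of this chain are left-modular, it satisfies the level condition, and its levels satisfy $A_i=B_i$ for all $i\in\{1,\dots,n\}$, where $B_i$ is the set of atoms $a$ with $\lambda(\hat 0,a)=i$. -/

import Mathlib

/-! ### Leaf-labelled rooted binary forests -/

/-- A forest of rooted binary trees (not considered as planar) whose leaves are bijectively
labelled by `I`.  Every vertex of such a forest is determined by the set of its ancestor leaves,
so a vertex *is* here the set of labels of its ancestor leaves: the leaf `i` is `{i}`, and an inner
vertex is a set with at least two elements.  The root of each tree is the end of an extra
half-line attached below the bottom vertex of the tree, and need not be recorded. -/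
@[ext]
structure Forest (I : Type*) [DecidableEq I] where
  /-- the inner vertices -/
  inner : Finset (Finset I)
  /-- every inner vertex has at least two ancestor leaves -/
  nontrivial : ∀ v ∈ inner, 2 ≤ v.card
  /-- two vertices are on a common path to a root, or have no ancestor leaf in common -/
  laminar : ∀ u ∈ inner, ∀ v ∈ inner, u ⊆ v ∨ v ⊆ u ∨ Disjoint u v
  /-- exactly two edges enter every inner vertex: its ancestor leaves are the disjoint union of
  those of two vertices -/
  binary : ∀ v ∈ inner, ∃ a b : Finset I, (a ∈ inner ∨ ∃ i, a = {i}) ∧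
    (b ∈ inner ∨ ∃ i, b = {i}) ∧ Disjoint a b ∧ a ∪ b = v

namespace Forest

variable {I : Type*} [DecidableEq I]

/-- The vertices of `F` other than the roots: inner vertices and leaves.  For two vertices `u`, `v`,
the vertex `v` is on the path from `u` to the root if and only if `u ⊆ v`. -/
def IsVertex (F : Forest I) (u : Finset I) : Prop := u ∈ F.inner ∨ ∃ i, u = {i}

/-- There is an edge of `F`, oriented towards the root, from the vertex `u` to the inner
vertex `v`. -/
def IsEdge (F : Forest I) (u v : Finset I) : Prop :=
  F.IsVertex u ∧ v ∈ F.inner ∧ u ⊂ v ∧ ∀ w, F.IsVertex w → u ⊂ w → ¬ w ⊂ v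

/-- `F` is a tree: one vertex has all the leaves as ancestors. -/
def IsTree [Fintype I] (F : Forest I) : Prop := F.IsVertex Finset.univ

/-- The topological maps from `F` to `G` that define the order on forests, described (up to
isotopy) by the images of the vertices.  The edge from `u` to `v` is sent to the path from `φ u`
to `φ v` in `G`, and the half-line below the bottom vertex of each tree is sent to a short segment
below the image of that vertex.  An edge of the path from `φ u` to `φ v` is given by its upper end
`w`, which is a vertex with `φ u ⊆ w ⊂ φ v`. -/
structure IsForestMap (F G : Forest I) (φ : Finset I → Finset I) : Prop where
  /-- increasing with respect to the orientation towards the root -/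
  mono : ∀ u v, F.IsVertex u → F.IsVertex v → u ⊆ v → φ u ⊆ φ v
  /-- inner vertices are sent to inner vertices -/
  inner : ∀ v ∈ F.inner, φ v ∈ G.inner
  /-- injectively -/
  inner_inj : ∀ u ∈ F.inner, ∀ v ∈ F.inner, φ u = φ v → u = v
  /-- the identity on leaves -/
  leaf : ∀ i, φ {i} = {i}
  /-- injective on each tree: distinct edges of `F` in the same tree (i.e. above a common
  vertex `r`) are sent to paths without a common edge -/
  tree_inj : ∀ r u v u' v', F.IsVertex r → F.IsEdge u v → F.IsEdge u' v' → v ⊆ r → v' ⊆ r →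
    u ≠ u' → ∀ w, G.IsVertex w →
      ¬ ((φ u ⊆ w ∧ w ⊂ φ v) ∧ (φ u' ⊆ w ∧ w ⊂ φ v'))

variable {F G H : Forest I} {φ ψ : Finset I → Finset I}

theorem IsVertex.nonempty {u : Finset I} (h : F.IsVertex u) : u.Nonempty := by
  rcases h with h | ⟨i, rfl⟩
  · have := F.nontrivial u h
    exact Finset.card_pos.1 (by omega)
  · simp

theorem IsVertex.laminar {u v : Finset I} (hu : F.IsVertex u) (hv : F.IsVertex v) :
    u ⊆ v ∨ v ⊆ u ∨ Disjoint u v := by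
  rcases hu with hu | ⟨i, rfl⟩
  · rcases hv with hv | ⟨j, rfl⟩
    · exact F.laminar u hu v hv
    · by_cases h : j ∈ u <;> simp [h]
  · by_cases h : i ∈ v <;> simp [h]

theorem IsForestMap.isVertex (hφ : IsForestMap F G φ) {u : Finset I} (hu : F.IsVertex u) :
    G.IsVertex (φ u) := by
  rcases hu with hu | ⟨i, rfl⟩
  · exact Or.inl (hφ.inner u hu)
  · exact Or.inr ⟨i, hφ.leaf i⟩

theorem IsForestMap.exists_edge [Fintype I] (hψ : IsForestMap G H ψ) {x y w : Finset I}
    (hx : G.IsVertex x) (hy : y ∈ G.inner) (hxy : x ⊆ y) (hw : H.IsVertex w)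
    (h1 : ψ x ⊆ w) (h2 : w ⊂ ψ y) :
    ∃ p q, G.IsEdge p q ∧ x ⊆ p ∧ q ⊆ y ∧ ψ p ⊆ w ∧ w ⊂ ψ q := by
  classical
  obtain ⟨p, hp, hpmax⟩ := Finset.exists_max_image
    (Finset.univ.filter fun p => G.IsVertex p ∧ x ⊆ p ∧ p ⊆ y ∧ ψ p ⊆ w) Finset.card
    ⟨x, by simp [hx, hxy, h1]⟩
  simp only [Finset.mem_filter, Finset.mem_univ, true_and] at hp hpmax
  obtain ⟨hpv, hxp, hpy, hpw⟩ := hp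
  have hpy' : p ⊂ y := by
    refine hpy.ssubset_of_ne ?_
    rintro rfl
    exact h2.2 hpw
  obtain ⟨q, hq, hqmin⟩ := Finset.exists_min_image
    (Finset.univ.filter fun q => q ∈ G.inner ∧ p ⊂ q ∧ q ⊆ y) Finset.card
    ⟨y, by simp [hy, hpy']⟩
  simp only [Finset.mem_filter, Finset.mem_univ, true_and] at hq hqmin
  obtain ⟨hqi, hpq, hqy⟩ := hq
  refine ⟨p, q, ⟨hpv, hqi, hpq, ?_⟩, hxp, hqy, hpw, ?_⟩
  · intro z hz hpz hzq
    have hzi : z ∈ G.inner := by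
      rcases hz with hz | ⟨i, rfl⟩
      · exact hz
      · have h3 := Finset.card_lt_card hpz
        have h4 := Finset.card_pos.2 hpv.nonempty
        simp at h3
        simp [h3] at h4
    have := hqmin z ⟨hzi, hpz, hzq.subset.trans hqy⟩
    exact absurd (Finset.card_lt_card hzq) (by omega)
  · have hqw : ¬ ψ q ⊆ w := by
      intro h
      have := hpmax q ⟨Or.inl hqi, hxp.trans hpq.subset, hqy, h⟩
      exact absurd (Finset.card_lt_card hpq) (by omega)
    have hpq' : ψ p ⊆ ψ q := hψ.mono p q hpv (Or.inl hqi) hpq.subset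
    rcases hw.laminar (hψ.isVertex (Or.inl hqi)) with h | h | h
    · exact ⟨h, hqw⟩
    · exact absurd h hqw
    · obtain ⟨i, hi⟩ := (hψ.isVertex hpv).nonempty
      exact absurd (hpq' hi) (Finset.disjoint_left.1 h (hpw hi))

theorem isForestMap_id : IsForestMap F F id where
  mono _ _ _ _ h := h
  inner _ h := h
  inner_inj _ _ _ _ h := h
  leaf _ := rfl
  tree_inj := by
    rintro r u v u' v' - ⟨hu, hv, huv, hmin⟩ ⟨hu', hv', huv', hmin'⟩ - - hne w hw
      ⟨⟨h1, h2⟩, h3, h4⟩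
    simp only [id] at h1 h2 h3 h4
    have e1 : u = w := by
      by_contra h
      exact hmin w hw (h1.ssubset_of_ne h) h2
    have e2 : u' = w := by
      by_contra h
      exact hmin' w hw (h3.ssubset_of_ne h) h4
    exact hne (e1.trans e2.symm)

theorem IsForestMap.comp [Fintype I] (hψ : IsForestMap G H ψ) (hφ : IsForestMap F G φ) :
    IsForestMap F H (ψ ∘ φ) where
  mono u v hu hv h := hψ.mono _ _ (hφ.isVertex hu) (hφ.isVertex hv) (hφ.mono u v hu hv h)
  inner v hv := hψ.inner _ (hφ.inner v hv)
  inner_inj u hu v hv h :=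
    hφ.inner_inj u hu v hv (hψ.inner_inj _ (hφ.inner u hu) _ (hφ.inner v hv) h)
  leaf i := by simp [hφ.leaf, hψ.leaf]
  tree_inj := by
    rintro r u v u' v' hr he he' hvr hvr' hne w hw ⟨⟨h1, h2⟩, h3, h4⟩
    obtain ⟨p, q, hpq, hp, hq, h5, h6⟩ := hψ.exists_edge (hφ.isVertex he.1)
      (hφ.inner v he.2.1) (hφ.mono u v he.1 (Or.inl he.2.1) he.2.2.1.subset) hw h1 h2
    obtain ⟨p', q', hpq', hp', hq', h5', h6'⟩ := hψ.exists_edge (hφ.isVertex he'.1)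
      (hφ.inner v' he'.2.1) (hφ.mono u' v' he'.1 (Or.inl he'.2.1) he'.2.2.1.subset) hw h3 h4
    by_cases hpp : p = p'
    · subst hpp
      exact hφ.tree_inj r u v u' v' hr he he' hvr hvr' hne p hpq.1
        ⟨⟨hp, hpq.2.2.1.trans_subset hq⟩, hp', hpq'.2.2.1.trans_subset hq'⟩
    · exact hψ.tree_inj (φ r) p q p' q' (hφ.isVertex hr) hpq hpq'
        (hq.trans (hφ.mono v r (Or.inl he.2.1) hr hvr))
        (hq'.trans (hφ.mono v' r (Or.inl he'.2.1) hr hvr')) hpp w hw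
        ⟨⟨h5, h6⟩, h5', h6'⟩

theorem IsForestMap.subset_apply (hφ : IsForestMap F G φ) {v : Finset I} (hv : v ∈ F.inner) :
    v ⊆ φ v := by
  intro i hi
  have := hφ.mono {i} v (Or.inr ⟨i, rfl⟩) (Or.inl hv) (by simpa using hi)
  rw [hφ.leaf] at this
  simpa using this

theorem IsForestMap.card_sum_le (hφ : IsForestMap F G φ) :
    ∑ v ∈ F.inner, (φ v).card ≤ ∑ v ∈ G.inner, v.card := by
  classical
  rw [← Finset.sum_image (s := F.inner) (g := φ) (f := fun v => v.card)
    (fun u hu v hv h => hφ.inner_inj u hu v hv h)]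
  refine Finset.sum_le_sum_of_subset ?_
  intro w hw
  obtain ⟨v, hv, rfl⟩ := Finset.mem_image.1 hw
  exact hφ.inner v hv

theorem IsForestMap.inner_subset (hφ : IsForestMap F G φ) (hψ : IsForestMap G F ψ) :
    F.inner ⊆ G.inner := by
  have h1 : ∑ v ∈ F.inner, v.card ≤ ∑ v ∈ F.inner, (φ v).card :=
    Finset.sum_le_sum fun v hv => Finset.card_le_card (hφ.subset_apply hv)
  have h2 : ∑ v ∈ G.inner, v.card ≤ ∑ v ∈ G.inner, (ψ v).card :=
    Finset.sum_le_sum fun v hv => Finset.card_le_card (hψ.subset_apply hv)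
  have h3 : ∑ v ∈ F.inner, v.card = ∑ v ∈ F.inner, (φ v).card :=
    le_antisymm h1 (hφ.card_sum_le.trans (h2.trans hψ.card_sum_le))
  have h4 := (Finset.sum_eq_sum_iff_of_le
    fun v hv => Finset.card_le_card (hφ.subset_apply hv)).1 h3
  intro v hv
  have := Finset.eq_of_subset_of_card_le (hφ.subset_apply hv) (h4 v hv).ge
  rw [this]
  exact hφ.inner v hv

/-- The poset `For(I)` of forests on `I`. -/
instance [Fintype I] : PartialOrder (Forest I) where
  le F G := ∃ φ, IsForestMap F G φ
  le_refl _ := ⟨id, isForestMap_id⟩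
  le_trans _ _ _ := fun ⟨_, hφ⟩ ⟨_, hψ⟩ => ⟨_, hψ.comp hφ⟩
  le_antisymm _ _ := fun ⟨_, hφ⟩ ⟨_, hψ⟩ =>
    Forest.ext ((hφ.inner_subset hψ).antisymm (hψ.inner_subset hφ))

/-- `0̂` is the forest without inner vertices. -/
instance [Fintype I] : OrderBot (Forest I) where
  bot := ⟨∅, by simp, by simp, by simp⟩
  bot_le _ := ⟨id, by
    refine ⟨fun _ _ _ _ h => h, by simp, by simp, fun _ => rfl, ?_⟩
    rintro r u v u' v' - he
    exact absurd he.2.1 (by simp)⟩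

/-- The interval `[0̂, T]` in the poset of forests. -/
abbrev Interval [Fintype I] (T : Forest I) : Type _ := Set.Icc (⊥ : Forest I) T

instance [Fintype I] (T : Forest I) : BoundedOrder T.Interval where
  bot := ⟨⊥, le_rfl, bot_le⟩
  bot_le F := F.2.1
  top := ⟨T, bot_le, le_rfl⟩
  le_top F := F.2.2

/-- The set `𝒱(F)` of inner vertices of a forest `F ≤ T`, regarded as a subset of `𝒱(T)` through
the map from `F` to `T` (whose values at the vertices are unique). -/
def verticesIn (F T : Forest I) : Set (Finset I) :=
  {w | ∃ φ, IsForestMap F T φ ∧ ∃ v ∈ F.inner, φ v = w}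

/-- `v` is the inner vertex `v_(i,j)` of `T`: the paths from the leaves `i` and `j` to the root
meet at `v`, and at no vertex above `v`. -/
def IsMeetingVertex (T : Forest I) (i j : I) (v : Finset I) : Prop :=
  v ∈ T.inner ∧ i ∈ v ∧ j ∈ v ∧ ∀ w ∈ T.inner, i ∈ w → j ∈ w → v ⊆ w

/-- `a` is the atom `(i,j)` (the forest whose only inner vertex joins the leaves `i` and `j`) for
some distinct `i` and `j`, and `v` is the inner vertex `v_(i,j)` of `T` associated to it. -/
def IsAtomVertex (a T : Forest I) (v : Finset I) : Prop :=
  ∃ i j : I, i ≠ j ∧ a.inner = {{i, j}} ∧ T.IsMeetingVertex i j v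

/-- A nice total order on the inner vertices of `T`, given by the numbering of the vertices in
increasing order (by `0, …, n - 1`): it extends the order in which `u` is smaller than `v` if `v`
is on the path from `u` to the root. -/
structure NiceLabeling (T : Forest I) (n : ℕ) where
  /-- the numbering -/
  label : {v // v ∈ T.inner} ≃ Fin n
  mono : ∀ u v : {v // v ∈ T.inner}, u.1 ⊆ v.1 → label u ≤ label v

/-- The label `λ(F, G)` of the covering relation `F ⋖ G` in `[0̂, T]` is `k`: the set `𝒱(G)` is
obtained from `𝒱(F)` by adding the vertex number `k`. -/
def IsEdgeLabel [Fintype I] {T : Forest I} {n : ℕ} (l : T.NiceLabeling n) (F G : T.Interval)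
    (k : Fin n) : Prop :=
  F ⋖ G ∧ (l.label.symm k).1 ∉ F.1.verticesIn T ∧
    G.1.verticesIn T = insert (l.label.symm k).1 (F.1.verticesIn T)

/-- The chain `x_0 ⋖ x_1 ⋖ ⋯` is increasing for the edge-labeling. -/
def IsIncreasing [Fintype I] {T : Forest I} {n m : ℕ} (l : T.NiceLabeling n)
    (x : Fin (m + 1) → T.Interval) : Prop :=
  ∃ c : Fin m → Fin n, (∀ i, IsEdgeLabel l (x i.castSucc) (x i.succ) (c i)) ∧ Monotone c

/-- The set `B_k` of atoms `a` with `λ(0̂, a) = k`. -/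
def labelClass [Fintype I] {T : Forest I} {n : ℕ} (l : T.NiceLabeling n) (k : Fin n) :
    Set T.Interval :=
  {a | IsAtom a ∧ IsEdgeLabel l ⊥ a k}

end Forest

/-! ### LL-lattices -/

/-- A poset in which every pair of elements has a meet and a join. -/
def IsLatticeOrder (P : Type*) [PartialOrder P] : Prop :=
  ∀ x y : P, (∃ z, IsGLB {x, y} z) ∧ ∃ z, IsLUB {x, y} z

/-- The meet and join operations of a poset in which all meets and joins of pairs exist. -/
@[reducible]
noncomputable def IsLatticeOrder.toLattice {P : Type*} [inst : PartialOrder P]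
    (h : IsLatticeOrder P) : Lattice P where
  toPartialOrder := inst
  sup x y := (h x y).2.choose
  le_sup_left x y := (h x y).2.choose_spec.1 (by simp)
  le_sup_right x y := (h x y).2.choose_spec.1 (by simp)
  sup_le x y z hx hy := (h x y).2.choose_spec.2 (by simp [upperBounds, hx, hy])
  inf x y := (h x y).1.choose
  inf_le_left x y := (h x y).1.choose_spec.1 (by simp)
  inf_le_right x y := (h x y).1.choose_spec.1 (by simp)
  le_inf z x y hx hy := (h x y).1.choose_spec.2 (by simp [lowerBounds, hx, hy])

/-- `0̂ = x_0 ⋖ x_1 ⋖ ⋯ ⋖ x_n = 1̂`. -/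
def IsMaximalChain {P : Type*} [PartialOrder P] [BoundedOrder P] {n : ℕ}
    (x : Fin (n + 1) → P) : Prop :=
  x 0 = ⊥ ∧ x (Fin.last n) = ⊤ ∧ ∀ i : Fin n, x i.castSucc ⋖ x i.succ

/-- The levels of atoms with respect to the chain `x`; the index `i : Fin n` stands for the
number `i + 1` of `{1, …, n}`. -/
def atomLevel {P : Type*} [PartialOrder P] [BoundedOrder P] {n : ℕ} (x : Fin (n + 1) → P)
    (i : Fin n) : Set P :=
  {a | IsAtom a ∧ a ≤ x i.succ ∧ ¬ a ≤ x i.castSucc}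

/-- The order on atoms induced by the chain `x`. -/
def InducedLT {P : Type*} [PartialOrder P] [BoundedOrder P] {n : ℕ} (x : Fin (n + 1) → P)
    (a b : P) : Prop :=
  ∃ i j : Fin n, a ∈ atomLevel x i ∧ b ∈ atomLevel x j ∧ i < j

/-- A left-modular element of a lattice. -/
def IsLeftModular {L : Type*} [Lattice L] (x : L) : Prop :=
  ∀ y z : L, y ≤ z → y ⊔ (x ⊓ z) = (y ⊔ x) ⊓ z

/-- The level condition with respect to the chain `x`: if the atoms `a_0, a_1, …, a_k` are
increasing for the induced order, then `a_0` is not below the join of `a_1, …, a_k`. -/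
def LevelCondition {L : Type*} [Lattice L] [BoundedOrder L] {n : ℕ} (x : Fin (n + 1) → L) :
    Prop :=
  ∀ (k : ℕ) (a : Fin (k + 1) → L), (∀ r, IsAtom (a r)) →
    (∀ r : Fin k, InducedLT x (a r.castSucc) (a r.succ)) →
    ¬ a 0 ≤ Finset.univ.sup fun r : Fin k => a r.succ

/-- A poset is an LL-lattice if it is a lattice and has a maximal chain which is left-modular and
satisfies the level condition. -/
def IsLLLattice (P : Type*) [PartialOrder P] [BoundedOrder P] : Prop :=
  ∃ h : IsLatticeOrder P,
    letI : Lattice P := h.toLattice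
    ∃ (n : ℕ) (x : Fin (n + 1) → P), IsMaximalChain x ∧ (∀ i, IsLeftModular (x i)) ∧
      LevelCondition x

/-! A forest below `T` amounts to a partition of the leaves, namely `rel`, the leaf sets of its
trees. A class crosses an inner vertex of `T` if two of its leaves meet there. A map of forests
preserves meeting vertices (`IsForestMap.apply_meet`), so injectivity on inner vertices says that no
vertex of `T` is crossed by two classes (`IsCompatible`), and 𝒱(F) is the set of crossed vertices.
Conversely, every compatible partition comes from restricting `T` to its classes (`ofSetoid_le`),
and the order is refinement (`le_of_rel_le`). Compatible partitions are closed under intersection,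
hence the lattice.

Three facts carry the rest. Comparable partitions with the same crossed vertices are equal
(`le_of_crossed_subset`). Merging the classes of two leaves that meet at an uncrossed vertex keeps
compatibility and adds only that vertex (`isCompatible_merge`, `crossed_merge`); iterating this
gives the vertices of a join of atoms with distinct vertices. An ancestral set `D` of vertices is
the vertex set of exactly one partition, and joining that partition to `y` adds only vertices of
`D`, which yields left-modularity.

For a nice total order, the first `k` vertices form an ancestral set, and these sets give the chain.
The labels along a maximal chain are distinct, so increasing labels force this chain. The level
condition holds because a join of atoms with distinct vertices has no further vertex. -/

namespace Forest

set_option linter.unusedSectionVars false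

variable {I : Type*} [Fintype I] [DecidableEq I] {F G T : Forest I} {φ : Finset I → Finset I}

/-! ### Smallest vertices -/

open Classical in
/-- The smallest vertex of `F` containing `S` (if there is a vertex containing `S`). -/
noncomputable def minVertex (F : Forest I) (S : Finset I) : Finset I :=
  Finset.univ.filter fun x => ∀ w, F.IsVertex w → S ⊆ w → x ∈ w

theorem mem_minVertex {S : Finset I} {x : I} :
    x ∈ F.minVertex S ↔ ∀ w, F.IsVertex w → S ⊆ w → x ∈ w := by
  simp [minVertex]

theorem subset_minVertex (F : Forest I) (S : Finset I) : S ⊆ F.minVertex S :=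
  fun _ hx => mem_minVertex.2 fun _ _ h => h hx

theorem minVertex_subset {S w : Finset I} (hw : F.IsVertex w) (h : S ⊆ w) :
    F.minVertex S ⊆ w :=
  fun _ hx => mem_minVertex.1 hx w hw h

theorem minVertex_mono (F : Forest I) {S S' : Finset I} (h : S ⊆ S') :
    F.minVertex S ⊆ F.minVertex S' :=
  fun _ hx => mem_minVertex.2 fun w hw h' => mem_minVertex.1 hx w hw (h.trans h')

theorem minVertex_of_isVertex {v : Finset I} (hv : F.IsVertex v) : F.minVertex v = v :=
  (minVertex_subset hv subset_rfl).antisymm (F.subset_minVertex v)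

/-- Two vertices with a common leaf above them are comparable. -/
theorem IsVertex.total {u v : Finset I} (hu : F.IsVertex u) (hv : F.IsVertex v) {a : I}
    (hau : a ∈ u) (hav : a ∈ v) : u ⊆ v ∨ v ⊆ u := by
  rcases hu.laminar hv with h | h | h
  · exact Or.inl h
  · exact Or.inr h
  · exact absurd hav (Finset.disjoint_left.1 h hau)

/-- The vertices containing a nonempty `S` share a leaf, so they form a chain, and their
intersection is the least of them. If there were none, `minVertex` would be all of `I`. -/
theorem isVertex_minVertex {S w : Finset I} (hS : S.Nonempty) (hw : F.IsVertex w) (h : S ⊆ w) :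
    F.IsVertex (F.minVertex S) := by
  classical
  obtain ⟨v, hv, hmin⟩ := Finset.exists_min_image
    (Finset.univ.filter fun v => F.IsVertex v ∧ S ⊆ v) Finset.card ⟨w, by simp [hw, h]⟩
  simp only [Finset.mem_filter, Finset.mem_univ, true_and] at hv hmin
  have : F.minVertex S = v := by
    refine (minVertex_subset hv.1 hv.2).antisymm fun x hx => mem_minVertex.2 fun u hu hSu => ?_
    obtain ⟨a, ha⟩ := hS
    rcases hv.1.total hu (hv.2 ha) (hSu ha) with h1 | h1
    · exact h1 hx
    · rwa [Finset.eq_of_subset_of_card_le h1 (hmin u ⟨hu, hSu⟩)]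
  rw [this]
  exact hv.1

theorem isVertex_singleton (F : Forest I) (i : I) : F.IsVertex {i} := Or.inr ⟨i, rfl⟩

theorem IsVertex.mem_inner {w : Finset I} (hw : F.IsVertex w) {a b : I} (ha : a ∈ w)
    (hb : b ∈ w) (hab : a ≠ b) : w ∈ F.inner := by
  rcases hw with hw | ⟨i, rfl⟩
  · exact hw
  · simp only [Finset.mem_singleton] at ha hb
    exact absurd (ha.trans hb.symm) hab

/-- The vertex at which the paths from the leaves `a` and `b` to the root meet. -/
noncomputable def meet (F : Forest I) (a b : I) : Finset I := F.minVertex {a, b}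

theorem meet_comm (F : Forest I) (a b : I) : F.meet a b = F.meet b a := by
  rw [meet, meet, Finset.pair_comm]

theorem meet_self (F : Forest I) (a : I) : F.meet a a = {a} := by
  simp [meet, minVertex_of_isVertex (F.isVertex_singleton a)]

theorem left_mem_meet (F : Forest I) (a b : I) : a ∈ F.meet a b :=
  F.subset_minVertex _ (by simp)

theorem right_mem_meet (F : Forest I) (a b : I) : b ∈ F.meet a b :=
  F.subset_minVertex _ (by simp)

theorem meet_subset {w : Finset I} (hw : F.IsVertex w) {a b : I} (ha : a ∈ w) (hb : b ∈ w) :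
    F.meet a b ⊆ w :=
  minVertex_subset hw (by simp [Finset.insert_subset_iff, ha, hb])

theorem isVertex_meet {w : Finset I} (hw : F.IsVertex w) {a b : I} (ha : a ∈ w) (hb : b ∈ w) :
    F.IsVertex (F.meet a b) :=
  isVertex_minVertex (by simp) hw (by simp [Finset.insert_subset_iff, ha, hb])

theorem meet_mem_inner {w : Finset I} (hw : F.IsVertex w) {a b : I} (ha : a ∈ w) (hb : b ∈ w)
    (hab : a ≠ b) : F.meet a b ∈ F.inner :=
  (isVertex_meet hw ha hb).mem_inner (F.left_mem_meet a b) (F.right_mem_meet a b) hab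

/-- A vertex strictly between `p` and `v` cannot exist: laminarity with `q` would make it meet `p`
inside `q`, contain all of `v`, or stay inside `p`. -/
theorem isEdge_of_disjoint {p q v : Finset I} (hp : F.IsVertex p) (hq : F.IsVertex q)
    (hv : v ∈ F.inner) (hpq : Disjoint p q) (h : p ∪ q = v) : F.IsEdge p v := by
  obtain ⟨b, hb⟩ := hq.nonempty
  have hbp : b ∉ p := Finset.disjoint_right.1 hpq hb
  have hpv : p ⊆ v := h ▸ Finset.subset_union_left
  have hqv : q ⊆ v := h ▸ Finset.subset_union_right
  refine ⟨hp, hv, ⟨hpv, fun h' => hbp (h' (hqv hb))⟩, fun w hw hpw hwv => ?_⟩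
  rcases hw.laminar hq with h1 | h1 | h1
  · obtain ⟨a, ha⟩ := hp.nonempty
    exact Finset.disjoint_left.1 hpq ha (h1 (hpw.1 ha))
  · exact hwv.2 (h ▸ Finset.union_subset hpw.1 h1)
  · refine hpw.2 fun x hx => ?_
    have hx' := hwv.1 hx
    rw [← h, Finset.mem_union] at hx'
    exact hx'.resolve_right (Finset.disjoint_left.1 h1 hx)

/-- The two edges entering the inner vertex `v`. -/
theorem exists_isEdge {v : Finset I} (hv : v ∈ F.inner) :
    ∃ p q, F.IsEdge p v ∧ F.IsEdge q v ∧ Disjoint p q ∧ p ∪ q = v := by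
  obtain ⟨p, q, hp, hq, hpq, h⟩ := F.binary v hv
  exact ⟨p, q, isEdge_of_disjoint hp hq hv hpq h,
    isEdge_of_disjoint hq hp hv hpq.symm (by rw [Finset.union_comm, h]), hpq, h⟩

/-- The two edges entering the vertex at which the paths from `a` and `b` meet. -/
theorem exists_isEdge_meet {w : Finset I} (hw : F.IsVertex w) {a b : I} (ha : a ∈ w) (hb : b ∈ w)
    (hab : a ≠ b) : ∃ p q, F.IsEdge p (F.meet a b) ∧ F.IsEdge q (F.meet a b) ∧ Disjoint p q ∧
      p ∪ q = F.meet a b ∧ a ∈ p ∧ b ∈ q := by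
  obtain ⟨p, q, hp, hq, hpq, h⟩ := exists_isEdge (meet_mem_inner hw ha hb hab)
  have hap : a ∈ p ∪ q := h ▸ F.left_mem_meet a b
  have hbp : b ∈ p ∪ q := h ▸ F.right_mem_meet a b
  rw [Finset.mem_union] at hap hbp
  rcases hap with hap | hap <;> rcases hbp with hbp | hbp
  · exact absurd (meet_subset hp.1 hap hbp) hp.2.2.1.2
  · exact ⟨p, q, hp, hq, hpq, h, hap, hbp⟩
  · exact ⟨q, p, hq, hp, hpq.symm, by rw [Finset.union_comm, h], hap, hbp⟩
  · exact absurd (meet_subset hq.1 hap hbp) hq.2.2.1.2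

/-- Take one leaf on each of the two branches: a smaller meeting vertex would subdivide the edge
from `p` to `v`. -/
theorem exists_meet_eq {v : Finset I} (hv : v ∈ F.inner) : ∃ a b, a ≠ b ∧ F.meet a b = v := by
  obtain ⟨p, q, hp, hq, hpq, h⟩ := exists_isEdge hv
  obtain ⟨a, ha⟩ := hp.1.nonempty
  obtain ⟨b, hb⟩ := hq.1.nonempty
  have hbp : b ∉ p := Finset.disjoint_right.1 hpq hb
  have hav := hp.2.2.1.1 ha
  have hbv := hq.2.2.1.1 hb
  refine ⟨a, b, fun hab => hbp (hab ▸ ha), ?_⟩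
  have hm := isVertex_meet (Or.inl hv) hav hbv
  by_contra hne
  refine hp.2.2.2 _ hm ?_ ((meet_subset (Or.inl hv) hav hbv).ssubset_of_ne hne)
  rcases hm.total hp.1 (F.left_mem_meet a b) ha with h1 | h1
  · exact absurd (h1 (F.right_mem_meet a b)) hbp
  · exact ⟨h1, fun h2 => hbp (h2 (F.right_mem_meet a b))⟩

/-! ### Maps of forests and meeting vertices -/

theorem IsForestMap.apply_ne (hφ : IsForestMap F G φ) {p v : Finset I} (hp : F.IsVertex p)
    (hv : v ∈ F.inner) (hpv : p ≠ v) : φ p ≠ φ v := by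
  rcases hp with hp | ⟨i, rfl⟩
  · exact fun h => hpv (hφ.inner_inj p hp v hv h)
  · intro h
    have := G.nontrivial _ (hφ.inner v hv)
    rw [← h, hφ.leaf] at this
    simp at this

theorem IsForestMap.subset_apply_of_isVertex (hφ : IsForestMap F G φ) {v : Finset I}
    (hv : F.IsVertex v) : v ⊆ φ v := by
  rcases hv with hv | ⟨i, rfl⟩
  · exact hφ.subset_apply hv
  · rw [hφ.leaf]

/-- The two edges entering the meeting vertex `u` go to paths that end at `φ u` and share no edge.
If `a` and `b` met in `G` strictly above `φ u`, the two paths would have a common final edge. -/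
theorem IsForestMap.apply_meet (hφ : IsForestMap F G φ) {w : Finset I} (hw : F.IsVertex w)
    {a b : I} (ha : a ∈ w) (hb : b ∈ w) : φ (F.meet a b) = G.meet a b := by
  by_cases hab : a = b
  · subst hab
    rw [meet_self, meet_self, hφ.leaf]
  obtain ⟨p, q, hp, hq, hpq, h, hap, hbq⟩ := exists_isEdge_meet hw ha hb hab
  set u := F.meet a b
  have hu : F.IsVertex u := Or.inl hp.2.1
  have hau := hφ.subset_apply_of_isVertex hu (F.left_mem_meet a b)
  have hbu := hφ.subset_apply_of_isVertex hu (F.right_mem_meet a b)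
  have hpu := (hφ.mono p u hp.1 hu hp.2.2.1.1).ssubset_of_ne
    (hφ.apply_ne hp.1 hp.2.1 hp.2.2.1.ne)
  have hqu := (hφ.mono q u hq.1 hu hq.2.2.1.1).ssubset_of_ne
    (hφ.apply_ne hq.1 hq.2.1 hq.2.2.1.ne)
  have hpq' : p ≠ q := by
    rintro rfl
    exact Finset.disjoint_left.1 hpq hap hap
  have key := hφ.tree_inj u p u q u hu hp hq subset_rfl subset_rfl hpq'
  have hap' := hφ.subset_apply_of_isVertex hp.1 hap
  have hbq' := hφ.subset_apply_of_isVertex hq.1 hbq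
  have hm := isVertex_meet (hφ.isVertex hu) hau hbu
  -- Otherwise `φ p` contains `b` and is comparable with `φ q`; the larger of the two would then be
  -- the upper end of an edge common to both paths.
  have hpm : φ p ⊆ G.meet a b := by
    rcases (hφ.isVertex hp.1).total hm hap' (G.left_mem_meet a b) with h1 | h1
    · exact h1
    · have hbp := h1 (G.right_mem_meet a b)
      rcases (hφ.isVertex hp.1).total (hφ.isVertex hq.1) hbp hbq' with h2 | h2
      · exact absurd ⟨⟨h2, hqu⟩, subset_rfl, hqu⟩ (key _ (hφ.isVertex hq.1))
      · exact absurd ⟨⟨subset_rfl, hpu⟩, h2, hpu⟩ (key _ (hφ.isVertex hp.1))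
  have hqm : φ q ⊆ G.meet a b := by
    rcases (hφ.isVertex hq.1).total hm hbq' (G.right_mem_meet a b) with h1 | h1
    · exact h1
    · have haq := h1 (G.left_mem_meet a b)
      rcases (hφ.isVertex hp.1).total (hφ.isVertex hq.1) hap' haq with h2 | h2
      · exact absurd ⟨⟨h2, hqu⟩, subset_rfl, hqu⟩ (key _ (hφ.isVertex hq.1))
      · exact absurd ⟨⟨subset_rfl, hpu⟩, h2, hpu⟩ (key _ (hφ.isVertex hp.1))
  by_contra hne
  have hlt : G.meet a b ⊂ φ u :=
    (meet_subset (hφ.isVertex hu) hau hbu).ssubset_of_ne (Ne.symm hne)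
  exact key _ hm ⟨⟨hpm, hlt⟩, hqm, hlt⟩

/-- A criterion for `F ≤ G`. -/
theorem isForestMap_minVertex (hroot : ∀ v ∈ F.inner, ∃ w, G.IsVertex w ∧ v ⊆ w)
    (hinj : ∀ u ∈ F.inner, ∀ v ∈ F.inner, G.minVertex u = G.minVertex v → u = v)
    (hmeet : ∀ r, F.IsVertex r → ∀ a ∈ r, ∀ b ∈ r, a ≠ b →
      ∃ z, F.IsVertex z ∧ a ∈ z ∧ b ∈ z ∧ ∀ w, G.IsVertex w → a ∈ w → b ∈ w → z ⊆ w) :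
    IsForestMap F G G.minVertex where
  mono _ _ _ _ h := G.minVertex_mono h
  inner v hv := by
    obtain ⟨w, hw, hvw⟩ := hroot v hv
    obtain ⟨a, ha, b, hb, hab⟩ := Finset.one_lt_card.1 (F.nontrivial v hv)
    exact (isVertex_minVertex ⟨a, ha⟩ hw hvw).mem_inner (G.subset_minVertex v ha)
      (G.subset_minVertex v hb) hab
  inner_inj := hinj
  leaf i := minVertex_of_isVertex (G.isVertex_singleton i)
  tree_inj := by
    -- For nested edges, `v ⊆ u'`, so the first path ends before the second begins.
    have aux : ∀ u v u' v' w, F.IsEdge u v → F.IsEdge u' v' → u ⊆ u' → u ≠ u' →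
        G.minVertex u' ⊆ w → w ⊂ G.minVertex v → False := by
      intro u v u' v' w he he' huu hne h1 h2
      obtain ⟨a, ha⟩ := he.1.nonempty
      refine h2.2 ((G.minVertex_mono ?_).trans h1)
      rcases IsVertex.total (F := F) (Or.inl he.2.1) he'.1 (he.2.2.1.1 ha) (huu ha) with h | h
      · exact h
      · by_contra h'
        exact he.2.2.2 u' he'.1 (huu.ssubset_of_ne hne) ⟨h, h'⟩
    rintro r u v u' v' hr he he' hvr hvr' hne w hw ⟨⟨h1, h2⟩, h3, h4⟩
    rcases he.1.laminar he'.1 with h | h | h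
    · exact aux u v u' v' w he he' h hne h3 h2
    · exact aux u' v' u v w he' he h hne.symm h1 h4
    · obtain ⟨a, ha⟩ := he.1.nonempty
      obtain ⟨b, hb⟩ := he'.1.nonempty
      have hab : a ≠ b := by
        rintro rfl
        exact Finset.disjoint_left.1 h ha hb
      -- For edges on different branches, `v` lies inside `z`, and `z` lies inside every vertex of
      -- `G` that contains both `a` and `b`; a common edge `w` would thus contain the image of `v`.
      obtain ⟨z, hz, haz, hbz, hzw⟩ := hmeet r hr a (hvr (he.2.2.1.1 ha)) b
        (hvr' (he'.2.2.1.1 hb)) hab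
      have hbu : b ∉ u := Finset.disjoint_right.1 h hb
      have huz : u ⊂ z := by
        rcases he.1.total hz ha haz with h | h
        · exact ⟨h, fun h' => hbu (h' hbz)⟩
        · exact absurd (h hbz) hbu
      have hvz : v ⊆ z := by
        rcases IsVertex.total (F := F) (Or.inl he.2.1) hz (he.2.2.1.1 ha) haz with h | h
        · exact h
        · by_contra h'
          exact he.2.2.2 z hz huz ⟨h, h'⟩
      exact h2.2 (minVertex_subset hw (hvz.trans (hzw w hw
        (h1 (G.subset_minVertex _ ha)) (h3 (G.subset_minVertex _ hb)))))

/-! ### The partition defined by a forest -/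

/-- The equivalence relation on the leaves whose classes are the sets of leaves of the trees
of `F`. -/
def rel (F : Forest I) : Setoid I where
  r a b := ∃ v, F.IsVertex v ∧ a ∈ v ∧ b ∈ v
  iseqv := by
    refine ⟨fun a => ⟨{a}, F.isVertex_singleton a, by simp, by simp⟩,
      fun ⟨v, hv, h1, h2⟩ => ⟨v, hv, h2, h1⟩, ?_⟩
    rintro a b c ⟨u, hu, ha, hb⟩ ⟨v, hv, hb', hc⟩
    rcases hu.total hv hb hb' with h | h
    · exact ⟨v, hv, h ha, hc⟩
    · exact ⟨u, hu, ha, h hc⟩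

/-- Every vertex of `T` is crossed by at most one class of `r`. -/
def IsCompatible (T : Forest I) (r : Setoid I) : Prop :=
  ∀ a b c d, r a b → r c d → T.meet a b = T.meet c d → r a c

/-- The inner vertices of `T` crossed by some class of `r`. -/
def crossed (T : Forest I) (r : Setoid I) : Set (Finset I) :=
  {w | ∃ a b, r a b ∧ a ≠ b ∧ T.meet a b = w}

theorem crossed_mono (T : Forest I) {r s : Setoid I} (h : r ≤ s) : T.crossed r ⊆ T.crossed s := by
  rintro w ⟨a, b, hab, hne, hw⟩
  exact ⟨a, b, h hab, hne, hw⟩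

theorem eq_of_meet_eq_singleton {a c d : I} (h : {a} = T.meet c d) : a = c ∧ a = d := by
  have h1 := T.left_mem_meet c d
  have h2 := T.right_mem_meet c d
  rw [← h, Finset.mem_singleton] at h1 h2
  exact ⟨h1.symm, h2.symm⟩

/-- By `apply_meet`, two pairs meeting at one vertex of `T` meet at vertices of `F` with the same
image, which coincide by injectivity, so that all four leaves lie in one tree. -/
theorem isCompatible_rel (hF : F ≤ T) : T.IsCompatible F.rel := by
  obtain ⟨φ, hφ⟩ := hF
  rintro a b c d ⟨u, hu, ha, hb⟩ ⟨v, hv, hc, hd⟩ h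
  by_cases hab : a = b
  · subst hab
    rw [meet_self] at h
    rw [(eq_of_meet_eq_singleton h).1]
  by_cases hcd : c = d
  · subst hcd
    rw [meet_self] at h
    rw [(eq_of_meet_eq_singleton h.symm).1]
  rw [← hφ.apply_meet hu ha hb, ← hφ.apply_meet hv hc hd] at h
  have := hφ.inner_inj _ (meet_mem_inner hu ha hb hab) _ (meet_mem_inner hv hc hd hcd) h
  refine ⟨F.meet a b, isVertex_meet hu ha hb, F.left_mem_meet a b, ?_⟩
  rw [this]
  exact F.left_mem_meet c d

theorem verticesIn_eq_crossed (hF : F ≤ T) : F.verticesIn T = T.crossed F.rel := by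
  ext w
  constructor
  · rintro ⟨φ, hφ, v, hv, rfl⟩
    obtain ⟨a, b, hab, rfl⟩ := exists_meet_eq hv
    refine ⟨a, b, ⟨_, Or.inl hv, F.left_mem_meet a b, F.right_mem_meet a b⟩, hab, ?_⟩
    exact (hφ.apply_meet (Or.inl hv) (F.left_mem_meet a b) (F.right_mem_meet a b)).symm
  · rintro ⟨a, b, ⟨v, hv, ha, hb⟩, hab, rfl⟩
    obtain ⟨φ, hφ⟩ := hF
    exact ⟨φ, hφ, F.meet a b, meet_mem_inner hv ha hb hab, hφ.apply_meet hv ha hb⟩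

theorem rel_mono (h : F ≤ G) : F.rel ≤ G.rel := by
  obtain ⟨φ, hφ⟩ := h
  rintro a b ⟨v, hv, ha, hb⟩
  exact ⟨φ v, hφ.isVertex hv, hφ.subset_apply_of_isVertex hv ha,
    hφ.subset_apply_of_isVertex hv hb⟩

/-- The largest vertex containing `a` is the bottom of its tree. -/
theorem exists_isVertex_of_rel {S : Finset I} {a : I} (h : ∀ b ∈ S, F.rel a b) :
    ∃ w, F.IsVertex w ∧ S ⊆ w := by
  classical
  obtain ⟨w, hw, hmax⟩ := Finset.exists_max_image
    (Finset.univ.filter fun v => F.IsVertex v ∧ a ∈ v) Finset.card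
    ⟨{a}, by simp [F.isVertex_singleton]⟩
  simp only [Finset.mem_filter, Finset.mem_univ, true_and] at hw hmax
  refine ⟨w, hw.1, fun b hb => ?_⟩
  obtain ⟨v, hv, hav, hbv⟩ := h b hb
  rcases hv.total hw.1 hav hw.2 with h1 | h1
  · exact h1 hbv
  · rwa [Finset.eq_of_subset_of_card_le h1 (hmax v ⟨hv, hav⟩)]

/-- In a forest `G ≤ T`, the order of the meeting vertices is the same as in `T`. -/
theorem mem_meet_of_mem_meet (hG : G ≤ T) {a b k : I} (hab : G.rel a b)
    (hak : G.rel a k) (hk : T.meet a k ⊆ T.meet a b) : k ∈ G.meet a b := by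
  obtain ⟨φ, hφ⟩ := hG
  obtain ⟨u, hu, hau, hbu⟩ := hab
  obtain ⟨v, hv, hav, hkv⟩ := hak
  have h1 := isVertex_meet hu hau hbu
  have h2 := isVertex_meet hv hav hkv
  rcases h2.total h1 (G.left_mem_meet a k) (G.left_mem_meet a b) with h | h
  · exact h (G.right_mem_meet a k)
  by_cases hak : a = k
  · exact hak ▸ G.left_mem_meet a b
  -- If the meeting vertex with `k` were strictly larger in `G`, its image would be squeezed onto
  -- that of `G.meet a b`, contradicting injectivity.
  have h3 := hφ.mono _ _ h1 h2 h
  rw [hφ.apply_meet hu hau hbu, hφ.apply_meet hv hav hkv] at h3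
  by_contra hne
  refine hφ.apply_ne h1 (meet_mem_inner hv hav hkv hak) ?_ ?_
  · rintro h4
    exact hne (h4 ▸ G.right_mem_meet a k)
  · rw [hφ.apply_meet hu hau hbu, hφ.apply_meet hv hav hkv]
    exact h3.antisymm hk

theorem subset_meet_of_rel_le (hF : F ≤ T) (hG : G ≤ T) (h : F.rel ≤ G.rel) {a b : I}
    (hab : F.rel a b) : F.meet a b ⊆ G.meet a b := by
  obtain ⟨φ, hφ⟩ := hF
  intro k hk
  have h0 := hab
  obtain ⟨u, hu, hau, hbu⟩ := hab
  have h1 := isVertex_meet hu hau hbu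
  refine mem_meet_of_mem_meet hG (h h0) (h ⟨_, h1, F.left_mem_meet a b, hk⟩) ?_
  rw [← hφ.apply_meet h1 (F.left_mem_meet a b) hk, ← hφ.apply_meet hu hau hbu]
  exact hφ.mono _ _ (isVertex_meet h1 (F.left_mem_meet a b) hk) h1
    (meet_subset h1 (F.left_mem_meet a b) hk)

/-- The map sends a vertex of `F` to the smallest vertex of `G` containing it. Followed by `ψ`, it
agrees with `φ` on inner vertices, so it inherits injectivity from `φ`. -/
theorem le_of_rel_le (hF : F ≤ T) (hG : G ≤ T) (h : F.rel ≤ G.rel) : F ≤ G := by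
  have key : ∀ a b, F.rel a b → F.meet a b ⊆ G.meet a b :=
    fun a b hab => subset_meet_of_rel_le hF hG h hab
  have hrel : ∀ {v}, v ∈ F.inner → ∀ {a b}, a ∈ v → b ∈ v → F.rel a b :=
    fun hv _ _ ha hb => ⟨_, Or.inl hv, ha, hb⟩
  have hmin : ∀ a b, F.rel a b → G.minVertex (F.meet a b) = G.meet a b := by
    intro a b hab
    obtain ⟨w, hw, ha, hb⟩ := h hab
    refine (minVertex_subset (isVertex_meet hw ha hb) (key a b hab)).antisymm ?_
    refine G.minVertex_mono ?_
    simp [Finset.insert_subset_iff, F.left_mem_meet, F.right_mem_meet]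
  obtain ⟨φ, hφ⟩ := hF
  obtain ⟨ψ, hψ⟩ := hG
  refine ⟨_, isForestMap_minVertex ?_ ?_ ?_⟩
  · intro v hv
    obtain ⟨a, ha⟩ := IsVertex.nonempty (F := F) (Or.inl hv)
    exact exists_isVertex_of_rel fun b hb => h (hrel hv ha hb)
  · have hcomp : ∀ v ∈ F.inner, ψ (G.minVertex v) = φ v := by
      intro v hv
      obtain ⟨a, b, hab, rfl⟩ := exists_meet_eq hv
      have hr := hrel hv (F.left_mem_meet a b) (F.right_mem_meet a b)
      rw [hmin a b hr]
      obtain ⟨w, hw, ha, hb⟩ := h hr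
      rw [hψ.apply_meet hw ha hb, hφ.apply_meet (Or.inl hv) (F.left_mem_meet a b)
        (F.right_mem_meet a b)]
    intro u hu v hv huv
    exact hφ.inner_inj u hu v hv (by rw [← hcomp u hu, ← hcomp v hv, huv])
  · intro r hr a ha b hb hab
    exact ⟨F.meet a b, isVertex_meet hr ha hb, F.left_mem_meet a b, F.right_mem_meet a b,
      fun w hw haw hbw => (key a b ⟨r, hr, ha, hb⟩).trans (meet_subset hw haw hbw)⟩

/-! ### Meeting vertices in a tree -/

theorem IsTree.isVertex_meet (hT : T.IsTree) (a b : I) : T.IsVertex (T.meet a b) :=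
  Forest.isVertex_meet hT (Finset.mem_univ a) (Finset.mem_univ b)

theorem IsTree.meet_mem_inner (hT : T.IsTree) {a b : I} (hab : a ≠ b) : T.meet a b ∈ T.inner :=
  Forest.meet_mem_inner hT (Finset.mem_univ a) (Finset.mem_univ b) hab

theorem IsTree.meet_subset (hT : T.IsTree) {a b c d : I} (ha : a ∈ T.meet c d)
    (hb : b ∈ T.meet c d) : T.meet a b ⊆ T.meet c d :=
  Forest.meet_subset (hT.isVertex_meet c d) ha hb

theorem IsTree.meet_total (hT : T.IsTree) {x a b c d : I} (h1 : x ∈ T.meet a b)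
    (h2 : x ∈ T.meet c d) : T.meet a b ⊆ T.meet c d ∨ T.meet c d ⊆ T.meet a b :=
  (hT.isVertex_meet a b).total (hT.isVertex_meet c d) h1 h2

/-- Binarity enters here: `c` is on the branch of `a` or on that of `b`. -/
theorem IsTree.meet_ssubset_or (hT : T.IsTree) {a b c : I} (hab : a ≠ b)
    (hc : c ∈ T.meet a b) : T.meet a c ⊂ T.meet a b ∨ T.meet b c ⊂ T.meet a b := by
  obtain ⟨p, q, hp, hq, -, h, hap, hbq⟩ :=
    exists_isEdge_meet hT (Finset.mem_univ a) (Finset.mem_univ b) hab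
  rw [← h, Finset.mem_union] at hc
  rcases hc with hc | hc
  · exact Or.inl ((Forest.meet_subset hp.1 hap hc).trans_ssubset hp.2.2.1)
  · exact Or.inr ((Forest.meet_subset hq.1 hbq hc).trans_ssubset hq.2.2.1)

/-- The isosceles rule of an ultrametric, with meeting vertices as distances. -/
theorem IsTree.meet_eq_of_ssubset (hT : T.IsTree) {a b c : I}
    (h : T.meet a b ⊂ T.meet b c) : T.meet a c = T.meet b c := by
  refine (hT.meet_subset (h.1 (T.left_mem_meet a b)) (T.right_mem_meet b c)).antisymm ?_
  rcases hT.meet_total (T.left_mem_meet a b) (T.left_mem_meet a c) with h1 | h1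
  · exact hT.meet_subset (h1 (T.right_mem_meet a b)) (T.right_mem_meet a c)
  · exact absurd (hT.meet_subset (T.right_mem_meet a b) (h1 (T.right_mem_meet a c))) h.2

/-- Each pair has one leaf on each of the two branches, which matches the pairs up. -/
theorem IsTree.meet_cases (hT : T.IsTree) {a b c d : I} (hab : a ≠ b)
    (h : T.meet c d = T.meet a b) :
    (T.meet a c ⊂ T.meet a b ∧ T.meet b d ⊂ T.meet a b) ∨
      (T.meet a d ⊂ T.meet a b ∧ T.meet b c ⊂ T.meet a b) := by
  have hc : c ∈ T.meet a b := h ▸ T.left_mem_meet c d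
  have hd : d ∈ T.meet a b := h ▸ T.right_mem_meet c d
  rcases hT.meet_ssubset_or hab hc with h1 | h1 <;> rcases hT.meet_ssubset_or hab hd with h2 | h2
  · rw [← h] at h1 h2
    rw [hT.meet_eq_of_ssubset h1] at h2
    exact absurd h2 (ssubset_irrefl _)
  · exact Or.inl ⟨h1, h2⟩
  · exact Or.inr ⟨h2, h1⟩
  · rw [← h] at h1 h2
    rw [hT.meet_eq_of_ssubset h1] at h2
    exact absurd h2 (ssubset_irrefl _)

/-! ### The forest defined by a compatible partition -/

open Classical in
/-- The part of the vertex `T.meet a b` that lies in the class of `a`. -/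
noncomputable def part (T : Forest I) (r : Setoid I) (a b : I) : Finset I :=
  (T.meet a b).filter fun x => r a x

theorem mem_part {r : Setoid I} {a b x : I} :
    x ∈ T.part r a b ↔ x ∈ T.meet a b ∧ r a x := by
  simp [part]

theorem left_mem_part (T : Forest I) (r : Setoid I) (a b : I) : a ∈ T.part r a b :=
  mem_part.2 ⟨T.left_mem_meet a b, r.refl a⟩

theorem right_mem_part {r : Setoid I} {a b : I} (h : r a b) : b ∈ T.part r a b :=
  mem_part.2 ⟨T.right_mem_meet a b, h⟩

theorem part_self (T : Forest I) (r : Setoid I) (a : I) : T.part r a a = {a} := by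
  ext x
  rw [mem_part, meet_self, Finset.mem_singleton]
  exact ⟨fun h => h.1, fun h => ⟨h, h ▸ r.refl a⟩⟩

theorem part_eq {r : Setoid I} {a b c d : I} (h : T.meet a b = T.meet c d) (hac : r a c) :
    T.part r a b = T.part r c d := by
  ext x
  rw [mem_part, mem_part, h]
  exact and_congr_right fun _ => ⟨fun hx => r.trans (r.symm hac) hx, fun hx => r.trans hac hx⟩

/-- The leaves of the class on the branch of `a` form again a part: take `k` among them with `T.meet
a k` as large as possible. The case `k = a` gives a leaf. -/
theorem IsTree.exists_part_eq_child (hT : T.IsTree) (r : Setoid I) {a b : I} (hab : a ≠ b) :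
    ∃ k, r a k ∧ ∀ x, x ∈ T.part r a k ↔ r a x ∧ T.meet a x ⊂ T.meet a b := by
  classical
  have ha : T.meet a a ⊂ T.meet a b := by
    rw [meet_self]
    refine ⟨by simp [T.left_mem_meet], fun h => hab ?_⟩
    exact (Finset.mem_singleton.1 (h (T.right_mem_meet a b))).symm
  obtain ⟨k, hk, hmax⟩ := Finset.exists_max_image
    (Finset.univ.filter fun x => r a x ∧ T.meet a x ⊂ T.meet a b)
    (fun x => (T.meet a x).card) ⟨a, by
      simp only [Finset.mem_filter, Finset.mem_univ, true_and]
      exact ⟨r.refl a, ha⟩⟩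
  simp only [Finset.mem_filter, Finset.mem_univ, true_and] at hk hmax
  refine ⟨k, hk.1, fun x => ?_⟩
  rw [mem_part]
  constructor
  · rintro ⟨h1, h2⟩
    exact ⟨h2, (hT.meet_subset (T.left_mem_meet a k) h1).trans_ssubset hk.2⟩
  · rintro ⟨h1, h2⟩
    refine ⟨?_, h1⟩
    rcases hT.meet_total (T.left_mem_meet a x) (T.left_mem_meet a k) with h3 | h3
    · exact h3 (T.right_mem_meet a x)
    · rw [Finset.eq_of_subset_of_card_le h3 (hmax x ⟨h1, h2⟩)]
      exact T.right_mem_meet a x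

open Classical in
/-- The forest whose trees are the restrictions of `T` to the classes of `r`. -/
noncomputable def ofSetoid (T : Forest I) (hT : T.IsTree) (r : Setoid I) : Forest I where
  inner := Finset.univ.filter fun v => ∃ a b, r a b ∧ a ≠ b ∧ v = T.part r a b
  nontrivial v hv := by
    simp only [Finset.mem_filter, Finset.mem_univ, true_and] at hv
    obtain ⟨a, b, hr, hab, rfl⟩ := hv
    exact Finset.one_lt_card.2 ⟨a, left_mem_part T r a b, b, right_mem_part hr, hab⟩
  laminar u hu v hv := by
    simp only [Finset.mem_filter, Finset.mem_univ, true_and] at hu hv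
    obtain ⟨a, b, hr, hab, rfl⟩ := hu
    obtain ⟨c, d, hr', hcd, rfl⟩ := hv
    by_cases hac : r a c
    · rcases (hT.isVertex_meet a b).laminar (hT.isVertex_meet c d) with h | h | h
      · refine Or.inl fun x hx => ?_
        rw [mem_part] at hx ⊢
        exact ⟨h hx.1, r.trans (r.symm hac) hx.2⟩
      · refine Or.inr (Or.inl fun x hx => ?_)
        rw [mem_part] at hx ⊢
        exact ⟨h hx.1, r.trans hac hx.2⟩
      · refine Or.inr (Or.inr (Finset.disjoint_left.2 fun x hx hx' => ?_))
        exact Finset.disjoint_left.1 h (mem_part.1 hx).1 (mem_part.1 hx').1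
    · refine Or.inr (Or.inr (Finset.disjoint_left.2 fun x hx hx' => hac ?_))
      exact r.trans (mem_part.1 hx).2 (r.symm (mem_part.1 hx').2)
  binary v hv := by
    simp only [Finset.mem_filter, Finset.mem_univ, true_and] at hv ⊢
    obtain ⟨a, b, hr, hab, rfl⟩ := hv
    have key : ∀ a k, r a k → ((∃ a' b', r a' b' ∧ a' ≠ b' ∧ T.part r a k = T.part r a' b') ∨
        ∃ i, T.part r a k = {i}) := by
      intro a k hk
      by_cases h : a = k
      · subst h
        exact Or.inr ⟨a, part_self T r a⟩
      · exact Or.inl ⟨a, k, hk, h, rfl⟩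
    obtain ⟨k, hk, hk'⟩ := hT.exists_part_eq_child r hab
    obtain ⟨l, hl, hl'⟩ := hT.exists_part_eq_child r hab.symm
    rw [T.meet_comm b a] at hl'
    refine ⟨T.part r a k, T.part r b l, key a k hk, key b l hl, ?_, ?_⟩
    · refine Finset.disjoint_left.2 fun x hx hx' => ?_
      have h1 := ((hk' x).1 hx).2
      have h2 := ((hl' x).1 hx').2
      have h3 := hT.meet_eq_of_ssubset (a := x) (b := a) (c := b) (by rwa [T.meet_comm x a])
      rw [T.meet_comm b x, h3] at h2
      exact ssubset_irrefl _ h2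
    · ext x
      rw [Finset.mem_union, hk', hl', mem_part]
      constructor
      · rintro (⟨h1, h2⟩ | ⟨h1, h2⟩)
        · exact ⟨h2.1 (T.right_mem_meet a x), h1⟩
        · exact ⟨h2.1 (T.right_mem_meet b x), r.trans hr h1⟩
      · rintro ⟨h1, h2⟩
        rcases hT.meet_ssubset_or hab h1 with h3 | h3
        · exact Or.inl ⟨h2, h3⟩
        · exact Or.inr ⟨r.trans (r.symm hr) h2, h3⟩

theorem mem_inner_ofSetoid {hT : T.IsTree} {r : Setoid I} {v : Finset I} :
    v ∈ (T.ofSetoid hT r).inner ↔ ∃ a b, r a b ∧ a ≠ b ∧ v = T.part r a b := by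
  simp [ofSetoid]

theorem isVertex_part {hT : T.IsTree} {r : Setoid I} {a b : I} (h : r a b) :
    (T.ofSetoid hT r).IsVertex (T.part r a b) := by
  by_cases hab : a = b
  · subst hab
    exact Or.inr ⟨a, part_self T r a⟩
  · exact Or.inl (mem_inner_ofSetoid.2 ⟨a, b, h, hab, rfl⟩)

theorem rel_ofSetoid (hT : T.IsTree) (r : Setoid I) : (T.ofSetoid hT r).rel = r := by
  ext a b
  constructor
  · rintro ⟨v, hv | ⟨i, rfl⟩, ha, hb⟩
    · obtain ⟨c, d, -, -, rfl⟩ := mem_inner_ofSetoid.1 hv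
      exact r.trans (r.symm (mem_part.1 ha).2) (mem_part.1 hb).2
    · simp only [Finset.mem_singleton] at ha hb
      rw [ha, hb]
  · exact fun h => ⟨_, isVertex_part h, left_mem_part T r a b, right_mem_part h⟩

theorem minVertex_part (hT : T.IsTree) {r : Setoid I} {a b : I} (h : r a b) :
    T.minVertex (T.part r a b) = T.meet a b := by
  refine (minVertex_subset (hT.isVertex_meet a b) fun x hx => (mem_part.1 hx).1).antisymm ?_
  refine T.minVertex_mono ?_
  simp [Finset.insert_subset_iff, left_mem_part, right_mem_part h]

/-- A part of `T.meet a b` is sent to `T.meet a b`, so compatibility is what makes the map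
injective. -/
theorem ofSetoid_le (hT : T.IsTree) {r : Setoid I} (hr : T.IsCompatible r) :
    T.ofSetoid hT r ≤ T := by
  refine ⟨_, isForestMap_minVertex ?_ ?_ ?_⟩
  · exact fun v _ => ⟨Finset.univ, hT, Finset.subset_univ v⟩
  · intro u hu v hv huv
    obtain ⟨a, b, hab, -, rfl⟩ := mem_inner_ofSetoid.1 hu
    obtain ⟨c, d, hcd, -, rfl⟩ := mem_inner_ofSetoid.1 hv
    rw [minVertex_part hT hab, minVertex_part hT hcd] at huv
    exact part_eq huv (hr a b c d hab hcd huv)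
  · intro s hs a ha b hb hab
    have h : r a b := by
      rw [← rel_ofSetoid hT r]
      exact ⟨s, hs, ha, hb⟩
    exact ⟨T.part r a b, isVertex_part h, left_mem_part T r a b, right_mem_part h,
      fun w hw haw hbw x hx => Forest.meet_subset hw haw hbw (mem_part.1 hx).1⟩

/-! ### Compatible partitions -/

theorem isCompatible_bot (T : Forest I) : T.IsCompatible ⊥ := by
  intro a b c d hab hcd h
  obtain rfl : a = b := hab
  obtain rfl : c = d := hcd
  rw [meet_self] at h
  exact (eq_of_meet_eq_singleton h).1

theorem crossed_bot (T : Forest I) : T.crossed ⊥ = ∅ := by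
  ext w
  simp only [Set.mem_empty_iff_false, iff_false]
  rintro ⟨a, b, hab, hne, -⟩
  exact hne hab

theorem isCompatible_sInf {S : Set (Setoid I)} (hS : ∀ r ∈ S, T.IsCompatible r) :
    T.IsCompatible (sInf S) :=
  fun a b c d hab hcd h r hr => hS r hr a b c d (hab r hr) (hcd r hr) h

theorem isCompatible_inf {r s : Setoid I} (hr : T.IsCompatible r) (hs : T.IsCompatible s) :
    T.IsCompatible (r ⊓ s) :=
  fun a b c d hab hcd h => ⟨hr a b c d hab.1 hcd.1 h, hs a b c d hab.2 hcd.2 h⟩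

/-- A criterion for a partition to be coarser than another one. -/
theorem setoid_le_of_crossed (hT : T.IsTree) {r s : Setoid I}
    (hV : ∀ a b, s a b → a ≠ b → T.meet a b ∈ T.crossed r)
    (h : ∀ a b c d, s a b → r c d → T.meet c d = T.meet a b → s a c) : s ≤ r := by
  -- Induction on the size of the meeting vertex: a pair `c`, `d` of `r` crosses the same vertex,
  -- and its leaves are linked to `a` and `b` by pairs of `s` that meet at smaller vertices.
  have key : ∀ (n : ℕ) (a b : I), (T.meet a b).card = n → s a b → r a b := by
    intro n
    induction n using Nat.strong_induction_on with
    | _ n ih =>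
      intro a b hn hab
      by_cases hne : a = b
      · exact hne ▸ r.refl a
      obtain ⟨c, d, hcd, -, hm⟩ := hV a b hab hne
      have hm' : T.meet d c = T.meet a b := by rw [T.meet_comm, hm]
      have hac := h a b c d hab hcd hm
      have had := h a b d c hab (r.symm hcd) hm'
      have lt : ∀ x y, T.meet x y ⊂ T.meet a b → s x y → r x y :=
        fun x y hxy hs => ih _ (hn ▸ Finset.card_lt_card hxy) x y rfl hs
      rcases hT.meet_cases hne hm with ⟨h1, h2⟩ | ⟨h1, h2⟩
      · exact r.trans (lt _ _ h1 hac) (r.trans hcd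
          (r.symm (lt _ _ h2 (s.trans (s.symm hab) had))))
      · exact r.trans (lt _ _ h1 had) (r.trans (r.symm hcd)
          (r.symm (lt _ _ h2 (s.trans (s.symm hab) hac))))
  exact fun {a b} hab => key _ a b rfl hab

theorem le_of_crossed_subset (hT : T.IsTree) {r s : Setoid I} (hs : T.IsCompatible s)
    (hrs : r ≤ s) (h : T.crossed s ⊆ T.crossed r) : s ≤ r :=
  setoid_le_of_crossed hT (fun a b hab hne => h ⟨a, b, hab, hne, rfl⟩)
    fun a b c d hab hcd hm => hs a b c d hab (hrs hcd) hm.symm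

/-! ### Ancestral sets of vertices and their partitions -/

/-- A set of vertices closed under taking ancestors. -/
def IsAncestral (T : Forest I) (D : Set (Finset I)) : Prop :=
  D ⊆ {v | v ∈ T.inner} ∧ ∀ u ∈ T.inner, ∀ v ∈ D, u ⊆ v → u ∈ D

/-- The partition defined by an ancestral set of vertices. -/
def ancestralRel (hT : T.IsTree) {D : Set (Finset I)} (hD : T.IsAncestral D) : Setoid I where
  r a b := a = b ∨ T.meet a b ∈ D
  iseqv := by
    refine ⟨fun a => Or.inl rfl, fun h => ?_, fun {a b c} hab hbc => ?_⟩
    · rwa [eq_comm, T.meet_comm]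
    · rcases hab with rfl | hab
      · exact hbc
      rcases hbc with rfl | hbc
      · exact Or.inr hab
      by_cases hac : a = c
      · exact Or.inl hac
      right
      -- Both vertices contain `b`, so they are nested, and the larger contains `T.meet a c`.
      rcases hT.meet_total (T.right_mem_meet a b) (T.left_mem_meet b c) with h | h
      · exact hD.2 _ (hT.meet_mem_inner hac) _ hbc
          (hT.meet_subset (h (T.left_mem_meet a b)) (T.right_mem_meet b c))
      · exact hD.2 _ (hT.meet_mem_inner hac) _ hab
          (hT.meet_subset (T.left_mem_meet a b) (h (T.right_mem_meet b c)))

theorem ancestralRel_iff {hT : T.IsTree} {D : Set (Finset I)} {hD : T.IsAncestral D} {a b : I} :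
    ancestralRel hT hD a b ↔ a = b ∨ T.meet a b ∈ D := Iff.rfl

theorem ancestralRel_of_mem {hT : T.IsTree} {D : Set (Finset I)} {hD : T.IsAncestral D}
    {a b c : I} (hab : ancestralRel hT hD a b) (hc : c ∈ T.meet a b) :
    ancestralRel hT hD a c := by
  by_cases hac : a = c
  · exact Or.inl hac
  rcases hab with rfl | hab
  · rw [meet_self, Finset.mem_singleton] at hc
    exact absurd hc.symm hac
  · exact Or.inr (hD.2 _ (hT.meet_mem_inner hac) _ hab
      (hT.meet_subset (T.left_mem_meet a b) hc))

theorem isCompatible_ancestralRel (hT : T.IsTree) {D : Set (Finset I)} (hD : T.IsAncestral D) :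
    T.IsCompatible (ancestralRel hT hD) := fun _ _ c d hab _ h =>
  ancestralRel_of_mem hab (h ▸ T.left_mem_meet c d)

theorem crossed_ancestralRel (hT : T.IsTree) {D : Set (Finset I)} (hD : T.IsAncestral D) :
    T.crossed (ancestralRel hT hD) = D := by
  ext w
  constructor
  · rintro ⟨a, b, hab, hne, rfl⟩
    exact hab.resolve_left hne
  · intro hw
    obtain ⟨a, b, hne, rfl⟩ := exists_meet_eq (hD.1 hw)
    exact ⟨a, b, Or.inr hw, hne, rfl⟩

/-- A class that crosses a vertex of `D` contains all leaves above it, so every pair of `r` meeting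
there lies in this class. -/
theorem ancestralRel_le (hT : T.IsTree) {D : Set (Finset I)} (hD : T.IsAncestral D)
    {r : Setoid I} (h : D ⊆ T.crossed r) : ancestralRel hT hD ≤ r :=
  setoid_le_of_crossed hT (fun _ _ hab hne => h (hab.resolve_left hne))
    fun _ _ c d hab _ hm => ancestralRel_of_mem hab (hm ▸ T.left_mem_meet c d)

theorem eq_ancestralRel (hT : T.IsTree) {D : Set (Finset I)} (hD : T.IsAncestral D)
    {r : Setoid I} (h : T.crossed r = D) : r = ancestralRel hT hD := by
  refine le_antisymm (fun {a b} hab => ?_) (ancestralRel_le hT hD h.ge)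
  by_cases hne : a = b
  · exact Or.inl hne
  · exact Or.inr (h ▸ ⟨a, b, hab, hne, rfl⟩)

/-! ### Merging two classes -/

/-- The partition obtained by merging the classes of `i` and `j`. -/
def merge (r : Setoid I) (i j : I) : Setoid I where
  r a b := r a b ∨ (r a i ∧ r b j) ∨ (r a j ∧ r b i)
  iseqv := by
    refine ⟨fun a => Or.inl (r.refl a), ?_, ?_⟩
    · rintro a b (h | h | h)
      · exact Or.inl (r.symm h)
      · exact Or.inr (Or.inr ⟨h.2, h.1⟩)
      · exact Or.inr (Or.inl ⟨h.2, h.1⟩)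
    · rintro a b c (h | ⟨h1, h2⟩ | ⟨h1, h2⟩) (h' | ⟨h3, h4⟩ | ⟨h3, h4⟩)
      · exact Or.inl (r.trans h h')
      · exact Or.inr (Or.inl ⟨r.trans h h3, h4⟩)
      · exact Or.inr (Or.inr ⟨r.trans h h3, h4⟩)
      · exact Or.inr (Or.inl ⟨h1, r.trans (r.symm h') h2⟩)
      · exact Or.inl (r.trans h1 (r.trans (r.symm h3) (r.trans h2 (r.symm h4))))
      · exact Or.inl (r.trans h1 (r.symm h4))
      · exact Or.inr (Or.inr ⟨h1, r.trans (r.symm h') h2⟩)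
      · exact Or.inl (r.trans h1 (r.symm h4))
      · exact Or.inl (r.trans h1 (r.trans (r.symm h3) (r.trans h2 (r.symm h4))))

theorem le_merge (r : Setoid I) (i j : I) : r ≤ merge r i j := fun {_ _} h => Or.inl h

theorem merge_rel (r : Setoid I) (i j : I) : merge r i j i j :=
  Or.inr (Or.inl ⟨r.refl i, r.refl j⟩)

/-- In ultrametric terms, `a` and `b` meet at the largest of `T.meet a i`, `T.meet i j` and `T.meet
b j`; the hypotheses exclude ties for the maximum. -/
theorem meet_eq_of_rel (hT : T.IsTree) {r : Setoid I} (hr : T.IsCompatible r) {i j : I}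
    (hij : i ≠ j) (hw : T.meet i j ∉ T.crossed r) {a b : I} (ha : r a i) (hb : r b j) :
    T.meet a b = T.meet i j ∨ (a ≠ i ∧ T.meet a b = T.meet a i) ∨
      (b ≠ j ∧ T.meet a b = T.meet b j) := by
  have hnij : ¬ r i j := fun h => hw ⟨i, j, h, hij, rfl⟩
  -- Since `T.meet i j` is uncrossed, it differs from the meeting vertex of any related pair, and
  -- the comparison is strict.
  have cmp : ∀ {x y z : I}, r x y → y ≠ z → T.meet y z = T.meet i j →
      T.meet x y ⊂ T.meet i j ∨ (T.meet i j ⊂ T.meet x y ∧ x ≠ y) := by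
    intro x y z hxy hyz h
    rw [← h] at hw ⊢
    have hne : T.meet x y ≠ T.meet y z := by
      intro h'
      by_cases hxy' : x = y
      · subst hxy'
        rw [meet_self] at h'
        exact hyz (eq_of_meet_eq_singleton h').2
      · exact hw ⟨x, y, hxy, hxy', h'⟩
    rcases hT.meet_total (T.right_mem_meet x y) (T.left_mem_meet y z) with h1 | h1
    · exact Or.inl (h1.ssubset_of_ne hne)
    · refine Or.inr ⟨h1.ssubset_of_ne hne.symm, ?_⟩
      rintro rfl
      have := h1 (T.right_mem_meet x z)
      rw [meet_self, Finset.mem_singleton] at this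
      exact hyz this.symm
  rcases cmp ha hij rfl with h1 | ⟨h1, hai⟩ <;>
    rcases cmp hb hij.symm (T.meet_comm j i) with h2 | ⟨h2, hbj⟩
  · left
    have h3 := hT.meet_eq_of_ssubset h1
    rw [← h3, T.meet_comm a j] at h2
    rw [← h3, T.meet_comm a b, hT.meet_eq_of_ssubset h2, T.meet_comm]
  · right; right
    refine ⟨hbj, ?_⟩
    have h3 : T.meet a j ⊂ T.meet j b := by
      rw [hT.meet_eq_of_ssubset h1, T.meet_comm j b]
      exact h2
    rw [hT.meet_eq_of_ssubset h3, T.meet_comm]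
  · right; left
    refine ⟨hai, ?_⟩
    have h3 : T.meet b i ⊂ T.meet i a := by
      rw [hT.meet_eq_of_ssubset (c := i) (by rwa [T.meet_comm j i]), T.meet_comm j i,
        T.meet_comm i a]
      exact h1
    rw [T.meet_comm a b, hT.meet_eq_of_ssubset h3, T.meet_comm]
  -- By compatibility, equality would put `i` and `j` in one class, which would cross `T.meet i j`.
  · have hne : T.meet a i ≠ T.meet b j := fun h =>
      hnij (r.trans (r.symm ha) (r.trans (hr _ _ _ _ ha hb h) hb))
    rcases hT.meet_total (h1.1 (T.left_mem_meet i j)) (h2.1 (T.left_mem_meet i j)) with h3 | h3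
    · right; right
      refine ⟨hbj, ?_⟩
      have h4 : T.meet a j ⊂ T.meet j b := by
        rw [T.meet_comm j b]
        exact (hT.meet_subset (T.left_mem_meet a i) (h1.1 (T.right_mem_meet i j))).trans_ssubset
          (h3.ssubset_of_ne hne)
      rw [hT.meet_eq_of_ssubset h4, T.meet_comm]
    · right; left
      refine ⟨hai, ?_⟩
      have h4 : T.meet b i ⊂ T.meet i a := by
        rw [T.meet_comm i a]
        exact (hT.meet_subset (T.left_mem_meet b j) (h2.1 (T.left_mem_meet i j))).trans_ssubset
          (h3.ssubset_of_ne hne.symm)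
      rw [T.meet_comm a b, hT.meet_eq_of_ssubset h4, T.meet_comm]

/-- Besides bounding the crossed vertices, each alternative records which merged class does the
crossing; compatibility of the merge rests on this. -/
theorem meet_of_merge (hT : T.IsTree) {r : Setoid I} (hr : T.IsCompatible r) {i j : I}
    (hij : i ≠ j) (hw : T.meet i j ∉ T.crossed r) {a b : I} (hab : merge r i j a b)
    (hne : a ≠ b) :
    (∃ a' b', r a' b' ∧ a' ≠ b' ∧ T.meet a' b' = T.meet a b ∧ merge r i j a a') ∨
      (T.meet a b = T.meet i j ∧ merge r i j a i) := by
  have hab' := hab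
  rcases hab with h | ⟨h1, h2⟩ | ⟨h1, h2⟩
  · exact Or.inl ⟨a, b, h, hne, rfl, Setoid.refl' _ a⟩
  · rcases meet_eq_of_rel hT hr hij hw h1 h2 with h | ⟨h, h'⟩ | ⟨h, h'⟩
    · exact Or.inr ⟨h, Or.inl h1⟩
    · exact Or.inl ⟨a, i, h1, h, h'.symm, Setoid.refl' _ a⟩
    · exact Or.inl ⟨b, j, h2, h, h'.symm, hab'⟩
  · have h3 := meet_eq_of_rel hT hr hij hw h2 h1
    rw [T.meet_comm b a] at h3
    rcases h3 with h | ⟨h, h'⟩ | ⟨h, h'⟩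
    · exact Or.inr ⟨h, Or.inr (Or.inr ⟨h1, r.refl i⟩)⟩
    · exact Or.inl ⟨b, i, h2, h, h'.symm, hab'⟩
    · exact Or.inl ⟨a, j, h1, h, h'.symm, Setoid.refl' _ a⟩

theorem isCompatible_merge (hT : T.IsTree) {r : Setoid I} (hr : T.IsCompatible r) {i j : I}
    (hij : i ≠ j) (hw : T.meet i j ∉ T.crossed r) : T.IsCompatible (merge r i j) := by
  intro a b c d hab hcd h
  by_cases hne : a = b
  · subst hne
    rw [meet_self] at h
    rw [(eq_of_meet_eq_singleton h).1]
  by_cases hne' : c = d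
  · subst hne'
    rw [meet_self] at h
    rw [(eq_of_meet_eq_singleton h.symm).1]
  rcases meet_of_merge hT hr hij hw hab hne with ⟨a', b', h1, h2, h3, h4⟩ | ⟨h1, h2⟩ <;>
    rcases meet_of_merge hT hr hij hw hcd hne' with ⟨c', d', h1', h2', h3', h4'⟩ | ⟨h1', h2'⟩
  · exact Setoid.trans' _ h4 (Setoid.trans' _
      (Or.inl (hr _ _ _ _ h1 h1' (h3.trans (h.trans h3'.symm)))) (Setoid.symm' _ h4'))
  · exact absurd ⟨a', b', h1, h2, h3.trans (h.trans h1')⟩ hw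
  · exact absurd ⟨c', d', h1', h2', h3'.trans (h.symm.trans h1)⟩ hw
  · exact Setoid.trans' _ h2 (Setoid.symm' _ h2')

theorem crossed_merge (hT : T.IsTree) {r : Setoid I} (hr : T.IsCompatible r) {i j : I}
    (hij : i ≠ j) (hw : T.meet i j ∉ T.crossed r) :
    T.crossed (merge r i j) = insert (T.meet i j) (T.crossed r) := by
  ext w
  constructor
  · rintro ⟨a, b, hab, hne, rfl⟩
    rcases meet_of_merge hT hr hij hw hab hne with ⟨a', b', h1, h2, h3, -⟩ | ⟨h1, -⟩
    · exact Or.inr ⟨a', b', h1, h2, h3⟩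
    · exact Or.inl h1
  · rintro (rfl | h)
    · exact ⟨i, j, merge_rel r i j, hij, rfl⟩
    · exact T.crossed_mono (le_merge r i j) h

/-- Pairs of leaves that meet at distinct vertices not crossed by `r` can be joined
simultaneously. -/
theorem exists_merge (hT : T.IsTree) {r : Setoid I} (hr : T.IsCompatible r) {ι : Type*}
    (s : Finset ι) (i j : ι → I) (hij : ∀ x ∈ s, i x ≠ j x)
    (hw : ∀ x ∈ s, T.meet (i x) (j x) ∉ T.crossed r)
    (hinj : Set.InjOn (fun x => T.meet (i x) (j x)) s) :
    ∃ t : Setoid I, T.IsCompatible t ∧ r ≤ t ∧ (∀ x ∈ s, t (i x) (j x)) ∧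
      T.crossed t = T.crossed r ∪ (fun x => T.meet (i x) (j x)) '' s := by
  classical
  induction s using Finset.induction_on with
  | empty => exact ⟨r, hr, le_rfl, by simp, by simp⟩
  | insert y s hy ih =>
    obtain ⟨t, ht, hrt, hts, htV⟩ := ih (fun x hx => hij x (Finset.mem_insert_of_mem hx))
      (fun x hx => hw x (Finset.mem_insert_of_mem hx))
      (hinj.mono (by simp))
    have hy' := Finset.mem_insert_self y s
    have hyt : T.meet (i y) (j y) ∉ T.crossed t := by
      rw [htV]
      rintro (h | ⟨x, hx, h⟩)
      · exact hw y hy' h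
      · exact hy (hinj (by simp) (Finset.mem_insert_of_mem hx : x ∈ _) h.symm ▸ hx)
    refine ⟨merge t (i y) (j y), isCompatible_merge hT ht (hij y hy') hyt,
      hrt.trans (le_merge _ _ _), ?_, ?_⟩
    · intro x hx
      rcases Finset.mem_insert.1 hx with rfl | hx
      · exact merge_rel _ _ _
      · exact le_merge _ _ _ (hts x hx)
    · rw [crossed_merge hT ht (hij y hy') hyt, htV, Finset.coe_insert, Set.image_insert_eq,
        Set.union_insert]

/-- There is a partition above `r` and the partition defined by the ancestral set `D` whose
vertices are those of `r` and those in `D`. -/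
theorem exists_crossed_eq_union (hT : T.IsTree) {r : Setoid I} (hr : T.IsCompatible r)
    {D : Set (Finset I)} (hD : T.IsAncestral D) :
    ∃ t : Setoid I, T.IsCompatible t ∧ r ≤ t ∧ ancestralRel hT hD ≤ t ∧
      T.crossed t = T.crossed r ∪ D := by
  classical
  have hmeet : ∀ x : {w // w ∈ D}, ∃ a b, a ≠ b ∧ T.meet a b = x.1 :=
    fun x => exists_meet_eq (hD.1 x.2)
  choose i j hij hm using hmeet
  -- Only the vertices of `D` not yet crossed by `r` call for a merge.
  obtain ⟨t, ht, hrt, -, htV⟩ := exists_merge hT hr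
    (Finset.univ.filter fun x : {w // w ∈ D} => x.1 ∉ T.crossed r) i j (fun x _ => hij x)
    (fun x hx => by simpa [hm] using hx) (fun x _ y _ h => by simpa [hm, Subtype.ext_iff] using h)
  have hV : T.crossed t = T.crossed r ∪ D := by
    rw [htV]
    ext w
    simp only [hm, Set.mem_union, Set.mem_image, Finset.coe_filter, Finset.mem_univ, true_and,
      Set.mem_ofPred_eq, Subtype.exists, exists_and_left, exists_prop]
    by_cases h : w ∈ T.crossed r <;> simp [h]
  exact ⟨t, ht, hrt, ancestralRel_le hT hD (hV ▸ Set.subset_union_right), hV⟩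

/-! ### The interval below a tree -/

theorem Interval.le_iff (x y : T.Interval) : x ≤ y ↔ x.1.rel ≤ y.1.rel :=
  ⟨fun h => rel_mono h, fun h => le_of_rel_le x.2.2 y.2.2 h⟩

theorem Interval.rel_injective {x y : T.Interval} (h : x.1.rel = y.1.rel) : x = y :=
  le_antisymm ((Interval.le_iff x y).2 h.le) ((Interval.le_iff y x).2 h.ge)

theorem Interval.isCompatible (x : T.Interval) : T.IsCompatible x.1.rel :=
  isCompatible_rel x.2.2

theorem Interval.verticesIn_eq (x : T.Interval) : x.1.verticesIn T = T.crossed x.1.rel :=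
  verticesIn_eq_crossed x.2.2

theorem Interval.verticesIn_mono {x y : T.Interval} (h : x ≤ y) :
    x.1.verticesIn T ⊆ y.1.verticesIn T := by
  rw [x.verticesIn_eq, y.verticesIn_eq]
  exact T.crossed_mono ((Interval.le_iff x y).1 h)

theorem exists_interval_rel_eq (hT : T.IsTree) {r : Setoid I} (hr : T.IsCompatible r) :
    ∃ x : T.Interval, x.1.rel = r :=
  ⟨⟨T.ofSetoid hT r, bot_le, ofSetoid_le hT hr⟩, rel_ofSetoid hT r⟩

theorem Interval.rel_eq_ancestralRel (hT : T.IsTree) {D : Set (Finset I)} (hD : T.IsAncestral D)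
    {x : T.Interval} (hx : x.1.verticesIn T = D) : x.1.rel = ancestralRel hT hD :=
  eq_ancestralRel hT hD (x.verticesIn_eq.symm.trans hx)

theorem Interval.le_of_verticesIn (hT : T.IsTree) {x y : T.Interval} (hxy : x ≤ y)
    (h : y.1.verticesIn T ⊆ x.1.verticesIn T) : y ≤ x := by
  rw [x.verticesIn_eq, y.verticesIn_eq] at h
  exact (Interval.le_iff y x).2
    (le_of_crossed_subset hT y.isCompatible ((Interval.le_iff x y).1 hxy) h)

theorem rel_bot : (⊥ : Forest I).rel = ⊥ := by
  ext a b
  constructor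
  · rintro ⟨v, hv | ⟨i, rfl⟩, ha, hb⟩
    · exact absurd hv (Finset.notMem_empty v)
    · simp only [Finset.mem_singleton] at ha hb
      exact ha.trans hb.symm
  · rintro h
    obtain rfl : a = b := h
    exact Setoid.refl' _ a

theorem verticesIn_bot : (⊥ : T.Interval).1.verticesIn T = ∅ := by
  rw [Interval.verticesIn_eq]
  change T.crossed (⊥ : Forest I).rel = ∅
  rw [rel_bot, crossed_bot]

theorem verticesIn_top : (⊤ : T.Interval).1.verticesIn T = {v | v ∈ T.inner} := by
  rw [Interval.verticesIn_eq]
  ext v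
  constructor
  · rintro ⟨a, b, ⟨w, hw, ha, hb⟩, hne, rfl⟩
    exact meet_mem_inner hw ha hb hne
  · intro hv
    obtain ⟨a, b, hne, rfl⟩ := exists_meet_eq hv
    exact ⟨a, b, ⟨_, Or.inl hv, T.left_mem_meet a b, T.right_mem_meet a b⟩, hne, rfl⟩

/-- The join of compatible partitions as mere partitions may be incompatible; the join here is the
intersection of all compatible partitions above both. -/
theorem isLatticeOrder_interval (hT : T.IsTree) : IsLatticeOrder T.Interval := by
  intro x y
  constructor
  · obtain ⟨z, hz⟩ := exists_interval_rel_eq hT (isCompatible_inf x.isCompatible y.isCompatible)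
    refine ⟨z, ?_, fun w hw => ?_⟩
    · rintro w (rfl | rfl)
      · exact (Interval.le_iff _ _).2 (hz.le.trans inf_le_left)
      · exact (Interval.le_iff _ _).2 (hz.le.trans inf_le_right)
    · exact (Interval.le_iff _ _).2 ((le_inf ((Interval.le_iff _ _).1 (hw (by simp)))
        ((Interval.le_iff _ _).1 (hw (by simp)))).trans hz.ge)
  · obtain ⟨z, hz⟩ := exists_interval_rel_eq hT
      (isCompatible_sInf (S := {r | T.IsCompatible r ∧ x.1.rel ≤ r ∧ y.1.rel ≤ r})
        fun r hr => hr.1)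
    refine ⟨z, ?_, fun w hw => ?_⟩
    · rintro w (rfl | rfl)
      · exact (Interval.le_iff _ _).2 ((le_sInf fun r hr => hr.2.1).trans hz.ge)
      · exact (Interval.le_iff _ _).2 ((le_sInf fun r hr => hr.2.2).trans hz.ge)
    · refine (Interval.le_iff _ _).2 (hz.le.trans (sInf_le ⟨w.isCompatible, ?_, ?_⟩))
      · exact (Interval.le_iff _ _).1 (hw (by simp))
      · exact (Interval.le_iff _ _).1 (hw (by simp))

theorem Interval.covBy_of_verticesIn (hT : T.IsTree) {x y : T.Interval} (hxy : x ≤ y)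
    {w : Finset I} (hw : w ∉ x.1.verticesIn T)
    (h : y.1.verticesIn T = insert w (x.1.verticesIn T)) : x ⋖ y := by
  refine ⟨lt_of_le_not_ge hxy fun hyx => hw (verticesIn_mono hyx (h ▸ Set.mem_insert _ _)),
    fun z hxz hzy => ?_⟩
  by_cases hwz : w ∈ z.1.verticesIn T
  · refine hzy.not_ge (le_of_verticesIn hT hzy.le ?_)
    rw [h]
    exact Set.insert_subset hwz (verticesIn_mono hxz.le)
  · refine hxz.not_ge (le_of_verticesIn hT hxz.le fun u hu => ?_)
    have hu' := verticesIn_mono hzy.le hu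
    rw [h] at hu'
    rcases hu' with rfl | hu'
    · exact absurd hu hwz
    · exact hu'

/-! ### Atoms -/

/-- The forest whose only inner vertex joins the leaves `i` and `j`. -/
def pair {i j : I} (hij : i ≠ j) : Forest I where
  inner := {{i, j}}
  nontrivial v hv := by
    rw [Finset.mem_singleton.1 hv, Finset.card_pair hij]
  laminar u hu v hv := by
    rw [Finset.mem_singleton.1 hu, Finset.mem_singleton.1 hv]
    exact Or.inl subset_rfl
  binary v hv := by
    rw [Finset.mem_singleton.1 hv]
    exact ⟨{i}, {j}, Or.inr ⟨i, rfl⟩, Or.inr ⟨j, rfl⟩, by simpa using hij, rfl⟩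

/-- A forest with a single inner vertex that joins two leaves is below every forest in which
these leaves are in the same tree. -/
theorem le_of_inner_eq_pair {i j : I} (hF : F.inner = {{i, j}}) (h : G.rel i j) : F ≤ G := by
  have hsub : ∀ w, i ∈ w → j ∈ w → ({i, j} : Finset I) ⊆ w := fun w hi hj => by
    simp [Finset.insert_subset_iff, hi, hj]
  refine ⟨_, isForestMap_minVertex ?_ ?_ ?_⟩
  · obtain ⟨w, hw, hi, hj⟩ := h
    intro v hv
    rw [hF, Finset.mem_singleton] at hv
    exact ⟨w, hw, hv ▸ hsub w hi hj⟩
  · intro u hu v hv _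
    rw [hF, Finset.mem_singleton] at hu hv
    rw [hu, hv]
  · intro r hr a ha b hb hab
    have hr' := hr.mem_inner ha hb hab
    rw [hF, Finset.mem_singleton] at hr'
    refine ⟨r, hr, ha, hb, fun w _ haw hbw => ?_⟩
    subst hr'
    simp only [Finset.mem_insert, Finset.mem_singleton] at ha hb
    rcases ha with rfl | rfl <;> rcases hb with rfl | rfl
    · exact absurd rfl hab
    · exact hsub w haw hbw
    · exact hsub w hbw haw
    · exact absurd rfl hab

theorem rel_of_inner_eq_pair {i j : I} (hF : F.inner = {{i, j}}) : F.rel i j :=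
  ⟨{i, j}, Or.inl (by simp [hF]), by simp, by simp⟩

theorem Interval.le_iff_rel_of_inner_eq_pair {a x : T.Interval} {i j : I}
    (ha : a.1.inner = {{i, j}}) : a ≤ x ↔ x.1.rel i j :=
  ⟨fun h => (Interval.le_iff a x).1 h (rel_of_inner_eq_pair ha), fun h => le_of_inner_eq_pair ha h⟩

theorem isMeetingVertex_iff (hT : T.IsTree) {i j : I} (hij : i ≠ j) {v : Finset I} :
    T.IsMeetingVertex i j v ↔ T.meet i j = v := by
  constructor
  · rintro ⟨hv, hi, hj, hmin⟩
    exact (Forest.meet_subset (Or.inl hv) hi hj).antisymm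
      (hmin _ (hT.meet_mem_inner hij) (T.left_mem_meet i j) (T.right_mem_meet i j))
  · rintro rfl
    exact ⟨hT.meet_mem_inner hij, T.left_mem_meet i j, T.right_mem_meet i j,
      fun w hw hi hj => Forest.meet_subset (Or.inl hw) hi hj⟩

/-- Two leaves above any inner vertex of `a` span a pair forest below `a`, which equals `a` by
atomicity. -/
theorem Interval.exists_inner_eq_pair {a : T.Interval} (ha : IsAtom a) :
    ∃ i j, i ≠ j ∧ a.1.inner = {{i, j}} := by
  have hne : a.1.inner ≠ ∅ := fun h => ha.1 (Subtype.ext (Forest.ext h))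
  obtain ⟨v, hv⟩ := Finset.nonempty_iff_ne_empty.2 hne
  obtain ⟨i, hi, j, hj, hij⟩ := Finset.one_lt_card.1 (a.1.nontrivial v hv)
  have hle : pair hij ≤ a.1 := le_of_inner_eq_pair rfl ⟨v, Or.inl hv, hi, hj⟩
  have hpa : (⟨pair hij, bot_le, hle.trans a.2.2⟩ : T.Interval) ≤ a := hle
  refine ⟨i, j, hij, ?_⟩
  rcases ha.le_iff.1 hpa with h | h
  · have h' := congrArg (fun x : T.Interval => x.1.inner) h
    exact absurd h' (Finset.singleton_ne_empty _)
  · exact (congrArg (fun x : T.Interval => x.1.inner) h).symm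

theorem existsUnique_isAtomVertex (hT : T.IsTree) {a : T.Interval} (ha : IsAtom a) :
    ∃! v, a.1.IsAtomVertex T v := by
  obtain ⟨i, j, hij, h⟩ := Interval.exists_inner_eq_pair ha
  refine ⟨T.meet i j, ⟨i, j, hij, h, (isMeetingVertex_iff hT hij).2 rfl⟩, ?_⟩
  rintro v ⟨i', j', hij', h', hv⟩
  rw [isMeetingVertex_iff hT hij'] at hv
  rw [h, Finset.singleton_inj] at h'
  rw [← hv, meet, ← h', meet]

theorem Interval.verticesIn_of_isAtomVertex (hT : T.IsTree) {a : T.Interval} {v : Finset I}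
    (h : a.1.IsAtomVertex T v) : a.1.verticesIn T = {v} := by
  obtain ⟨i, j, hij, hin, hv⟩ := h
  rw [isMeetingVertex_iff hT hij] at hv
  subst hv
  rw [a.verticesIn_eq]
  refine Set.Subset.antisymm ?_ ?_
  · rintro w ⟨x, y, ⟨u, hu, hx, hy⟩, hne, rfl⟩
    have hu' := hu.mem_inner hx hy hne
    rw [hin, Finset.mem_singleton] at hu'
    subst hu'
    simp only [Finset.mem_insert, Finset.mem_singleton] at hx hy
    rcases hx with rfl | rfl <;> rcases hy with rfl | rfl
    · exact absurd rfl hne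
    · rfl
    · exact T.meet_comm _ _
    · exact absurd rfl hne
  · rintro w rfl
    exact ⟨i, j, rel_of_inner_eq_pair hin, hij, rfl⟩

/-- The vertices of the join of atoms with distinct vertices. -/
theorem verticesIn_eq_range_of_isLUB (hT : T.IsTree) {ι : Type*} [Fintype ι]
    {a : ι → T.Interval} {v : ι → Finset I} (hv : ∀ r, (a r).1.IsAtomVertex T (v r))
    (hinj : Function.Injective v) {s : T.Interval} (hs : IsLUB (Set.range a) s) :
    s.1.verticesIn T = Set.range v := by
  refine Set.Subset.antisymm ?_ ?_
  · choose i j hij hin hm using hv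
    have hm' : ∀ r, T.meet (i r) (j r) = v r := fun r => (isMeetingVertex_iff hT (hij r)).1 (hm r)
    -- Merging all the pairs, starting from singletons, gives an upper bound of the atoms with no
    -- vertices but theirs.
    obtain ⟨t, ht, -, htr, htV⟩ := exists_merge hT (isCompatible_bot T) Finset.univ i j
      (fun r _ => hij r) (by simp [crossed_bot]) (fun x _ y _ h => hinj (by simpa [hm'] using h))
    obtain ⟨z, rfl⟩ := exists_interval_rel_eq hT ht
    have hsz : s ≤ z := by
      refine hs.2 ?_
      rintro _ ⟨r, rfl⟩
      exact (Interval.le_iff_rel_of_inner_eq_pair (hin r)).2 (htr r (Finset.mem_univ r))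
    refine (Interval.verticesIn_mono hsz).trans ?_
    rw [z.verticesIn_eq, htV, crossed_bot]
    simp [hm']
  · rintro _ ⟨r, rfl⟩
    refine Interval.verticesIn_mono (hs.1 ⟨r, rfl⟩) ?_
    rw [Interval.verticesIn_of_isAtomVertex hT (hv r)]
    rfl

theorem verticesIn_sup_atoms (hT : T.IsTree) (h : IsLatticeOrder T.Interval) :
    letI : Lattice T.Interval := h.toLattice
    ∀ (k : ℕ) (a : Fin k → T.Interval) (v : Fin k → Finset I),
      (∀ r, (a r).1.IsAtomVertex T (v r)) → Function.Injective v →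
      (Finset.univ.sup a).1.verticesIn T = Set.range v := by
  let : Lattice T.Interval := h.toLattice
  intro k a v hv hinj
  refine verticesIn_eq_range_of_isLUB hT hv hinj ⟨?_, fun z hz => ?_⟩
  · rintro _ ⟨r, rfl⟩
    exact Finset.le_sup (f := a) (Finset.mem_univ r)
  · exact Finset.sup_le fun r _ => hz ⟨r, rfl⟩

/-! ### Left-modularity -/

/-- One inequality holds in every lattice, so comparing vertex sets suffices. A vertex of `y ⊔ x` is
in 𝒱(y) or in `D`; if it is in `D` and is a vertex of `z`, a pair of `z` crossing it is also related
in `x`, so it is a vertex of `x ⊓ z`. -/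
theorem isLeftModular_of_isAncestral (hT : T.IsTree) (h : IsLatticeOrder T.Interval)
    {D : Set (Finset I)} (hD : T.IsAncestral D) {x : T.Interval} (hx : x.1.verticesIn T = D) :
    letI : Lattice T.Interval := h.toLattice
    IsLeftModular x := by
  let : Lattice T.Interval := h.toLattice
  intro y z hyz
  have hxr : x.1.rel = ancestralRel hT hD := Interval.rel_eq_ancestralRel hT hD hx
  have hle : y ⊔ (x ⊓ z) ≤ (y ⊔ x) ⊓ z :=
    le_inf (sup_le_sup_left inf_le_left y) (sup_le hyz inf_le_right)
  refine le_antisymm hle (Interval.le_of_verticesIn hT hle fun w hw => ?_)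
  have hwz := Interval.verticesIn_mono (inf_le_right : (y ⊔ x) ⊓ z ≤ z) hw
  have hwyx := Interval.verticesIn_mono (inf_le_left : (y ⊔ x) ⊓ z ≤ y ⊔ x) hw
  obtain ⟨t, ht, hyt, hxt, htV⟩ := exists_crossed_eq_union hT y.isCompatible hD
  obtain ⟨u, rfl⟩ := exists_interval_rel_eq hT ht
  have hyxu : y ⊔ x ≤ u :=
    sup_le ((Interval.le_iff y u).2 hyt) ((Interval.le_iff x u).2 (hxr ▸ hxt))
  have hwu := Interval.verticesIn_mono hyxu hwyx
  rw [u.verticesIn_eq, htV, ← y.verticesIn_eq] at hwu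
  rcases hwu with hwy | hwD
  · exact Interval.verticesIn_mono (le_sup_left : y ≤ y ⊔ (x ⊓ z)) hwy
  · refine Interval.verticesIn_mono (le_sup_right : x ⊓ z ≤ y ⊔ (x ⊓ z)) ?_
    rw [z.verticesIn_eq] at hwz
    obtain ⟨a, b, hab, hne, rfl⟩ := hwz
    obtain ⟨g, hg⟩ := exists_interval_rel_eq hT (isCompatible_inf x.isCompatible z.isCompatible)
    have hgle : g ≤ x ⊓ z :=
      le_inf ((Interval.le_iff g x).2 (hg.le.trans inf_le_left))
        ((Interval.le_iff g z).2 (hg.le.trans inf_le_right))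
    refine Interval.verticesIn_mono hgle ?_
    rw [g.verticesIn_eq, hg]
    exact ⟨a, b, ⟨by rw [hxr]; exact Or.inr hwD, hab⟩, hne, rfl⟩

/-! ### The chain defined by a nice total order -/

section NiceLabeling

variable {n : ℕ} (l : T.NiceLabeling n)

/-- The set of the first `k` vertices. -/
def NiceLabeling.firstVertices (k : ℕ) : Set (Finset I) :=
  {w | ∃ h : w ∈ T.inner, (l.label ⟨w, h⟩ : ℕ) < k}

theorem NiceLabeling.isAncestral_firstVertices (k : ℕ) : T.IsAncestral (l.firstVertices k) := by
  refine ⟨fun w hw => hw.1, ?_⟩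
  rintro u hu v ⟨hv, hk⟩ huv
  exact ⟨hu, lt_of_le_of_lt (l.mono ⟨u, hu⟩ ⟨v, hv⟩ huv) hk⟩

theorem NiceLabeling.symm_mem_firstVertices_iff {k : ℕ} {i : Fin n} :
    (l.label.symm i).1 ∈ l.firstVertices k ↔ (i : ℕ) < k := by
  constructor
  · rintro ⟨_, h⟩
    simpa using h
  · exact fun h => ⟨(l.label.symm i).2, by simpa using h⟩

theorem NiceLabeling.firstVertices_succ (i : Fin n) :
    l.firstVertices (i + 1) = insert (l.label.symm i).1 (l.firstVertices i) := by
  ext w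
  constructor
  · rintro ⟨h, hk⟩
    rcases Nat.lt_succ_iff_lt_or_eq.1 hk with hk | hk
    · exact Or.inr ⟨h, hk⟩
    · left
      rw [← Fin.ext hk, Equiv.symm_apply_apply]
  · rintro (rfl | ⟨h, hk⟩)
    · exact l.symm_mem_firstVertices_iff.2 (Nat.lt_succ_self _)
    · exact ⟨h, Nat.lt_succ_of_lt hk⟩

theorem NiceLabeling.firstVertices_zero : l.firstVertices 0 = ∅ :=
  Set.eq_empty_of_forall_notMem fun _ hw => Nat.not_lt_zero _ hw.2

theorem NiceLabeling.firstVertices_last : l.firstVertices n = {v | v ∈ T.inner} :=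
  Set.ext fun _ => ⟨fun h => h.1, fun h => ⟨h, Fin.is_lt _⟩⟩

theorem Interval.eq_of_verticesIn_eq (hT : T.IsTree) {D : Set (Finset I)} (hD : T.IsAncestral D)
    {x y : T.Interval} (hx : x.1.verticesIn T = D) (hy : y.1.verticesIn T = D) : x = y :=
  Interval.rel_injective ((Interval.rel_eq_ancestralRel hT hD hx).trans
    (Interval.rel_eq_ancestralRel hT hD hy).symm)

theorem NiceLabeling.isMaximalChain (hT : T.IsTree) {x : Fin (n + 1) → T.Interval}
    (hx : ∀ i, (x i).1.verticesIn T = l.firstVertices i) :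
    IsMaximalChain x ∧ IsIncreasing l x := by
  have hnot : ∀ i : Fin n, (l.label.symm i).1 ∉ (x i.castSucc).1.verticesIn T := by
    intro i
    rw [hx, l.symm_mem_firstVertices_iff]
    simp
  have hsucc : ∀ i : Fin n, (x i.succ).1.verticesIn T =
      insert (l.label.symm i).1 ((x i.castSucc).1.verticesIn T) := by
    intro i
    rw [hx, hx, Fin.val_succ, l.firstVertices_succ]
    rfl
  have hle : ∀ i : Fin n, x i.castSucc ≤ x i.succ := by
    intro i
    rw [Interval.le_iff, Interval.rel_eq_ancestralRel hT (l.isAncestral_firstVertices _)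
      (hx i.castSucc)]
    refine ancestralRel_le hT _ ?_
    rw [← Interval.verticesIn_eq, hsucc, hx]
    exact Set.subset_insert _ _
  have hcov : ∀ i : Fin n, x i.castSucc ⋖ x i.succ := fun i =>
    Interval.covBy_of_verticesIn hT (hle i) (hnot i) (hsucc i)
  refine ⟨⟨?_, ?_, hcov⟩, id, fun i => ⟨hcov i, hnot i, hsucc i⟩, monotone_id⟩
  · refine Interval.eq_of_verticesIn_eq hT (l.isAncestral_firstVertices 0) (hx 0) ?_
    rw [verticesIn_bot, l.firstVertices_zero]
  · refine Interval.eq_of_verticesIn_eq hT (l.isAncestral_firstVertices n)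
      (hx (Fin.last n)) ?_
    rw [verticesIn_top, l.firstVertices_last]

/-- A vertex once added stays, so no label repeats; a strictly increasing map from `Fin n` to itself
is the identity. -/
theorem NiceLabeling.verticesIn_eq_firstVertices {x : Fin (n + 1) → T.Interval}
    (hx : IsMaximalChain x) (hinc : IsIncreasing l x) (i : Fin (n + 1)) :
    (x i).1.verticesIn T = l.firstVertices i := by
  obtain ⟨c, hc, hmono⟩ := hinc
  have hxmono : Monotone x := (Fin.strictMono_iff_lt_succ.2 fun i => (hx.2.2 i).lt).monotone
  have hlt : ∀ i j : Fin n, i < j → c i ≠ c j := by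
    intro i j hij h
    refine (hc j).2.1 (Interval.verticesIn_mono (hxmono (Fin.succ_le_castSucc_iff.2 hij)) ?_)
    rw [(hc i).2.2, h]
    exact Set.mem_insert _ _
  have hstrict : StrictMono c := fun i j hij => (hmono hij.le).lt_of_ne (hlt i j hij)
  have hid : c = id := by
    refine (hstrict.range_inj strictMono_id).1 ?_
    rw [(Finite.injective_iff_surjective.1 hstrict.injective).range_eq, Set.range_id]
  subst hid
  induction i using Fin.induction with
  | zero =>
    rw [hx.1, verticesIn_bot]
    exact l.firstVertices_zero.symm
  | succ i ih =>
    rw [(hc i).2.2, ih, Fin.val_succ, l.firstVertices_succ]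
    rfl

theorem NiceLabeling.existsUnique_chain (hT : T.IsTree) :
    ∃! x : Fin (n + 1) → T.Interval, IsMaximalChain x ∧ IsIncreasing l x := by
  have hex : ∀ i : Fin (n + 1), ∃ x : T.Interval, x.1.verticesIn T = l.firstVertices i := by
    intro i
    obtain ⟨x, hx⟩ := exists_interval_rel_eq hT
      (isCompatible_ancestralRel hT (l.isAncestral_firstVertices i))
    exact ⟨x, by rw [x.verticesIn_eq, hx, crossed_ancestralRel]⟩
  choose x hx using hex
  refine ⟨x, l.isMaximalChain hT hx, fun y hy => funext fun i => ?_⟩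
  exact Interval.eq_of_verticesIn_eq hT (l.isAncestral_firstVertices i)
    (l.verticesIn_eq_firstVertices hy.1 hy.2 i) (hx i)

variable {x : Fin (n + 1) → T.Interval}

theorem NiceLabeling.mem_atomLevel_iff (hT : T.IsTree)
    (hx : ∀ i, (x i).1.verticesIn T = l.firstVertices i) {a : T.Interval} (ha : IsAtom a)
    {v : Finset I} (hv : a.1.IsAtomVertex T v) (k : Fin n) :
    a ∈ atomLevel x k ↔ (l.label.symm k).1 = v := by
  obtain ⟨i, j, hij, hin, hm⟩ := hv
  rw [isMeetingVertex_iff hT hij] at hm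
  subst hm
  -- Thus the atom enters the chain at the step that adds its own vertex.
  have hle : ∀ k, a ≤ x k ↔ T.meet i j ∈ l.firstVertices k := by
    intro k
    rw [Interval.le_iff_rel_of_inner_eq_pair hin,
      Interval.rel_eq_ancestralRel hT (l.isAncestral_firstVertices k) (hx k),
      ancestralRel_iff, or_iff_right hij]
  have hmem := hT.meet_mem_inner hij
  obtain ⟨m, hm⟩ := l.label.symm.surjective ⟨_, hmem⟩
  have hm' : T.meet i j = (l.label.symm m).1 := by rw [hm]
  rw [atomLevel, Set.mem_ofPred_eq, hle, hle, hm', l.symm_mem_firstVertices_iff,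
    l.symm_mem_firstVertices_iff, ← Subtype.ext_iff, l.label.symm.injective.eq_iff, Fin.ext_iff,
    Fin.val_succ, Fin.val_castSucc, and_iff_right ha]
  omega

theorem NiceLabeling.atomLevel_eq_labelClass (hT : T.IsTree)
    (hx : ∀ i, (x i).1.verticesIn T = l.firstVertices i) (k : Fin n) :
    atomLevel x k = labelClass l k := by
  ext a
  have aux : IsAtom a → (a ∈ atomLevel x k ↔ a ∈ labelClass l k) := by
    intro ha
    obtain ⟨v, hv, -⟩ := existsUnique_isAtomVertex hT ha
    rw [l.mem_atomLevel_iff hT hx ha hv, labelClass, Set.mem_ofPred_eq, and_iff_right ha,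
      IsEdgeLabel, verticesIn_bot, Interval.verticesIn_of_isAtomVertex hT hv,
      and_iff_right (bot_covBy_iff.2 ha), and_iff_right (Set.notMem_empty _),
      insert_empty_eq, Set.singleton_eq_singleton_iff, eq_comm]
  exact ⟨fun h => (aux h.1).1 h, fun h => (aux h.1).2 h⟩

/-- Increasing levels make the vertices of the atoms distinct, so the vertex of `a 0` is not among
those of the join. -/
theorem NiceLabeling.levelCondition (hT : T.IsTree) (h : IsLatticeOrder T.Interval)
    (hx : ∀ i, (x i).1.verticesIn T = l.firstVertices i) :
    letI : Lattice T.Interval := h.toLattice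
    LevelCondition x := by
  let : Lattice T.Interval := h.toLattice
  intro k a ha hlt hle
  choose v hv _ using fun r => existsUnique_isAtomVertex hT (ha r)
  have hinner : ∀ r, v r ∈ T.inner := fun r => by
    obtain ⟨i, j, -, -, h⟩ := hv r
    exact h.1
  have hlabel : ∀ r m, a r ∈ atomLevel x m → l.label ⟨v r, hinner r⟩ = m := by
    intro r m hm
    rw [l.mem_atomLevel_iff hT hx (ha r) (hv r)] at hm
    rw [← l.label.apply_symm_apply m]
    exact congrArg _ (Subtype.ext hm.symm)
  have hstrict : StrictMono fun r => l.label ⟨v r, hinner r⟩ := by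
    refine Fin.strictMono_iff_lt_succ.2 fun r => ?_
    obtain ⟨i, j, hi, hj, hij⟩ := hlt r
    change l.label _ < l.label _
    rwa [hlabel _ _ hi, hlabel _ _ hj]
  have hinj : Function.Injective v := fun r s hrs =>
    hstrict.injective (congrArg l.label (Subtype.ext hrs))
  have hsup := verticesIn_sup_atoms hT h k (fun r => a r.succ) (fun r => v r.succ)
    (fun r => hv r.succ) (hinj.comp (Fin.succ_injective k))
  have h0 := Interval.verticesIn_mono hle
  rw [hsup, Interval.verticesIn_of_isAtomVertex hT (hv 0), Set.singleton_subset_iff] at h0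
  obtain ⟨r, hr⟩ := h0
  exact Fin.succ_ne_zero r (hinj hr)

end NiceLabeling

/-- A linear extension of inclusion, enumerated increasingly. -/
theorem exists_niceLabeling (T : Forest I) : ∃ n, Nonempty (T.NiceLabeling n) := by
  classical
  have : Finite (LinearExtension {v // v ∈ T.inner}) :=
    inferInstanceAs (Finite {v // v ∈ T.inner})
  have := Fintype.ofFinite (LinearExtension {v // v ∈ T.inner})
  let e := (Fintype.orderIsoFinOfCardEq (LinearExtension {v // v ∈ T.inner}) rfl).symm
  exact ⟨_, ⟨⟨e.toEquiv, fun u v huv => e.monotone (toLinearExtension.monotone' huv)⟩⟩⟩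

end Forest

theorem mainTheorem4 {I : Type*} [Fintype I] [DecidableEq I] (T : Forest I) (hT : T.IsTree) :
    IsLLLattice T.Interval ∧
    ∃ h : IsLatticeOrder T.Interval,
      letI : Lattice T.Interval := h.toLattice
      (∀ a : T.Interval, IsAtom a → ∃! v, a.1.IsAtomVertex T v) ∧
      (∀ (k : ℕ) (a : Fin k → T.Interval) (v : Fin k → Finset I),
        (∀ r, IsAtom (a r)) → (∀ r, (a r).1.IsAtomVertex T (v r)) → Function.Injective v →
        (Finset.univ.sup a).1.verticesIn T = Set.range v) ∧
      ∀ (n : ℕ) (l : T.NiceLabeling n),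
        (∃! x : Fin (n + 1) → T.Interval, IsMaximalChain x ∧ Forest.IsIncreasing l x) ∧
        ∀ x : Fin (n + 1) → T.Interval, IsMaximalChain x → Forest.IsIncreasing l x →
          (∀ i, IsLeftModular (x i)) ∧ LevelCondition x ∧
          ∀ i, atomLevel x i = Forest.labelClass l i := by
  have h := Forest.isLatticeOrder_interval hT
  refine ⟨⟨h, ?_⟩, h, fun a ha => Forest.existsUnique_isAtomVertex hT ha,
    fun k a v _ hv hinj => Forest.verticesIn_sup_atoms hT h k a v hv hinj,
    fun n l => ⟨l.existsUnique_chain hT, fun x hx hinc => ?_⟩⟩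
  -- Any nice total order provides the chain required of an LL-lattice.
  · obtain ⟨n, ⟨l⟩⟩ := Forest.exists_niceLabeling T
    obtain ⟨x, ⟨hx, hinc⟩, -⟩ := l.existsUnique_chain hT
    have hV := l.verticesIn_eq_firstVertices hx hinc
    exact ⟨n, x, hx, fun i => Forest.isLeftModular_of_isAncestral hT h
      (l.isAncestral_firstVertices i) (hV i), l.levelCondition hT h hV⟩
  · have hV := l.verticesIn_eq_firstVertices hx hinc
    exact ⟨fun i => Forest.isLeftModular_of_isAncestral hT h
      (l.isAncestral_firstVertices i) (hV i), l.levelCondition hT h hV,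
      l.atomLevel_eq_labelClass hT hV⟩
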